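/- **Setting.** Let $\mathcal M=(\mathcal S,\mathcal A,r,P,\gamma,\mu)$ be a discounted Markov decision process with finite state and action sets, transition kernel $P$, known deterministic rewards $r$, discount factor $\gamma\in[0,1)$ and initial distribution $\mu$. For $\pi:\mathcal S\to\mathcal A$ let $V_\pi(s)=\mathbb E_{\pi,P}\big[\sum_{t\ge 0}\gamma^t r(s_t,a_t)\mid s_0=s\big]$ and $J(\pi)=\mathbb E_{s\sim\mu}[V_\pi(s)]$; $\pi$ is $\varepsilon$-optimal if $J(\pi)\ge J(\pi')-\varepsilon$ for all $\pi'$. Values are normalized to $[0,1]$: $0\le r(s,a)\le R_{\max}$ with $R_{\max}\le 1-\gamma$. An episode under $\pi$ consists of $H$ steps: $s_1\sim\mu$, and for $h=1,\dots,H$ the agent plays $a_h=\pi(s_h)$ and observes $s_{h+1}\sim P(\cdot\mid s_h,a_h)$. **Replicable statistical query.** $\mathsf{rSTAT}_{\tau,\rho',\delta'}(X,\phi)$ for a finite sample $X$ and $\phi$ with values in $[0,1]$: put $\alpha=2\tau/(\rho'+1-2\delta')$, draw $\alpha_{\rm off}$ uniformly from $[0,\alpha]$, cut $[0,1]$ at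 the points $\alpha_{\rm off}+j\alpha$ ($j\in\mathbb Z$), and return the midpoint of the piece that contains the empirical mean of $\phi$ on $X$. **Algorithm RepRMAX.** Initially the policy $\hat\pi$ is random (drawn from an arbitrary distribution on the policies), $K=\emptyset$, $n(s,a)=0$, $\widehat P(s'\mid s,a)=\mathbb 1[s'=s]$, $\widehat r(s,a)=R_{\max}$. While $\hat\pi$ is not $\varepsilon$-optimal for $\mathcal M$, do the following iteration. (1) Draw $m$ independent episodes under $\hat\pi$. (2) For every $(s,a)\notin K$ add to $n(s,a)$ the average over these episodes of the number of $h\in\{1,\dots,H\}$ with $(s_h,a_h)=(s,a)$; draw $k'$ uniformly from $[k,k+w]$; let $K_i$ be the set of the $(s,a)\notin K$ with $n(s,a)\ge k'$. (3) For every $(s,a)\in K_i$ set $\widehat r(s,a)=r(s,a)$ and, for every $s'$, $\widehat P(s'\mid s,a)=\mathsf{rSTAT}_{\tau_{SQ},\rho_{SQ},\delta_{SQ}}(S[(s,a)],\mathbb 1[\cdot=s'])$, where $S[(s,a)]$ is the multiset of next states observed from $(s,a)$ in all episodes so far, and where $\rho_{SQ}=\rho/(|\mathcal S|^2|\mathcal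 A|)$, $\delta_{SQ}=\delta/(|\mathcal S|^2|\mathcal A|)$, $\tau_{SQ}=c_\tau\,\varepsilon(1-\gamma)^2/|\mathcal S|$ with a constant $c_\tau$. (4) Add $K_i$ to $K$ and let $\hat\pi$ be an optimal policy of the model $(\widehat P,\widehat r,\gamma)$, i.e. one that maximizes at every state the discounted value computed with $\widehat P,\widehat r$ (by the same formula, although the rows of $\widehat P$ need not sum to exactly $1$); ties are broken by an arbitrary fixed rule, a function of the set of optimal policies. All random draws are independent. **Lemma (Convergence).** For all constants $c_\tau\in(0,1/2]$ and $c_w>0$ there are constants $C_T,C_m>0$, depending only on $c_\tau$ and $c_w$, such that the following holds for all such $\mathcal M$ and $R_{\max}$, all $H\in\mathbb N$, and all $\varepsilon,\delta,\rho\in(0,1)$ with $$\delta<\frac{\rho}{4},\qquad 1-\gamma>\frac{\sqrt{\varepsilon}\,\log^{1/4}(1/\delta)}{H|\mathcal A|\log^{1/4}(1/\rho)},$$ and such that an episode is long enough for the discount, $\gamma^H\le\varepsilon/2$. Let $$T\ \ge\ C_T\left(\frac{H|\mathcal S||\mathcal A|}{\varepsilon}+\frac{H^2\log(1/\delta)}{\varepsilon^2}\right),\qquad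 m\ \ge\ C_m\,\frac{|\mathcal S|^2|\mathcal A|^2T^4\log(1/\rho)}{\rho^2}\,\log\frac{|\mathcal S||\mathcal A|T}{\rho}$$ be integers (so that $T\in\Theta\big(\tfrac{H|\mathcal S||\mathcal A|}{\varepsilon}+\tfrac{H^2\log(1/\delta)}{\varepsilon^2}\big)$ iterations with $m\in\tilde O\big(\tfrac{|\mathcal S|^2|\mathcal A|^2T^4\log(1/\rho)}{\rho^2}\big)$ episodes each are enough), let $k=H$ and $0\le w\le c_w k$. Then, with probability at least $1-\delta$, the policy $\hat\pi$ of RepRMAX after $T$ iterations of the loop (or when the loop has stopped earlier) is $\varepsilon$-optimal. -/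

import Mathlib

open MeasureTheory

noncomputable section

namespace RepRMax

/-- A finite discounted Markov decision process with deterministic rewards: transition kernel `P`,
reward function `r`, discount factor `γ ∈ [0, 1)` and initial state distribution `μ`. -/
structure MDP (S A : Type*) where
  P : S → A → PMF S
  r : S → A → ℝ
  γ : ℝ
  μ : PMF S
  γ_nonneg : 0 ≤ γ
  γ_lt_one : γ < 1

/-- Transition weights and rewards of a (true or estimated) model. The rows of an estimated
transition matrix consist of separately answered statistical queries and need not sum to one. -/
structure Model (S A : Type*) where
  P : S → A → S → ℝ
  r : S → A → ℝ

namespace Model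

variable {S A : Type*} [Fintype S]

/-- Expected reward in the `t`-th step (counted from `0`) when following `π` from `s`. -/
def rewardAt (M : Model S A) (π : S → A) : ℕ → S → ℝ
  | 0, s => M.r s (π s)
  | t + 1, s => ∑ s', M.P s (π s) s' * rewardAt M π t s'

/-- The value `V_π(s)`: expected cumulative discounted reward over the infinite horizon. -/
def value (M : Model S A) (γ : ℝ) (π : S → A) (s : S) : ℝ :=
  ∑' t : ℕ, γ ^ t * M.rewardAt π t s

/-- `π` is an optimal policy of the model: it maximizes the value at every state. -/
def IsOptimal (M : Model S A) (γ : ℝ) (π : S → A) : Prop :=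
  ∀ (π' : S → A) (s : S), M.value γ π' s ≤ M.value γ π s

open Classical in
/-- The (finite) set of optimal policies of the model. -/
def optimalPolicies [Fintype A] (M : Model S A) (γ : ℝ) : Finset (S → A) :=
  Finset.univ.filter fun π => M.IsOptimal γ π

end Model

namespace MDP

variable {S A : Type*}

/-- The true model. -/
def toModel (M : MDP S A) : Model S A where
  P s a s' := (M.P s a s').toReal
  r := M.r

/-- The return `J(π)`: expected discounted reward of `π` from a random initial state. -/
def return_ [Fintype S] (M : MDP S A) (π : S → A) : ℝ :=
  ∑ s, (M.μ s).toReal * M.toModel.value M.γ π s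

/-- `π` is `ε`-optimal: no policy has a return that exceeds that of `π` by more than `ε`. -/
def IsEpsOptimal [Fintype S] (M : MDP S A) (ε : ℝ) (π : S → A) : Prop :=
  ∀ π' : S → A, M.return_ π' - ε ≤ M.return_ π

end MDP

/-! ### Episodes -/

/-- The randomness of one episode: the initial state, and for every step `h` and every pair
`(s, a)` the answer `s'` which the generative model gives in step `h` if it is asked for
`(s, a)`. -/
abbrev EpisodeNoise (S A : Type*) (H : ℕ) := S × (Fin H → S → A → S)

/-- The initial state is drawn from `μ`, and every answer for `(s, a)` is drawn from `P(· | s, a)`,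
all independently. -/
def episodeMeasure {S A : Type*} [Fintype S] [Fintype A] [MeasurableSpace S] (M : MDP S A)
    (H : ℕ) : Measure (EpisodeNoise S A H) :=
  M.μ.toMeasure.prod
    (Measure.pi fun _ => Measure.pi fun s => Measure.pi fun a => (M.P s a).toMeasure)

instance {S A : Type*} [Fintype S] [Fintype A] [MeasurableSpace S] (M : MDP S A) (H : ℕ) :
    IsProbabilityMeasure (episodeMeasure M H) := by
  unfold episodeMeasure; infer_instance

/-- The states visited by policy `π` in an episode of `H` steps: it starts in the initial state; in
step `h` the agent is in state `path h.castSucc`, plays the action of `π`, and moves to the state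
`path h.succ`. -/
def path {S A : Type*} {H : ℕ} (π : S → A) (ξ : EpisodeNoise S A H) : Fin (H + 1) → S :=
  Fin.induction (motive := fun _ => S) ξ.1 fun h s => ξ.2 h s (π s)

theorem path_eq_iff {S A : Type*} {H : ℕ} (π : S → A) (ξ : EpisodeNoise S A H)
    (x : Fin (H + 1) → S) :
    path π ξ = x ↔ ξ.1 = x 0 ∧
      ∀ h : Fin H, ξ.2 h (x h.castSucc) (π (x h.castSucc)) = x h.succ := by
  constructor
  · rintro rfl
    simp [path]
  · rintro ⟨h0, hs⟩
    funext i
    induction i using Fin.induction with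
    | zero => simpa [path] using h0
    | succ i ih =>
      rw [← hs i, ← ih]; simp [path]

/-- The visited states have the law `P^π(τ) = μ(s₁) ∏ₕ P(s_{h+1} | s_h, π(s_h))` of a trajectory of
`π` in the decision process. -/
theorem episodeMeasure_path {S A : Type*} [Fintype S] [Fintype A] [MeasurableSpace S]
    [DiscreteMeasurableSpace S] (M : MDP S A) (H : ℕ) (π : S → A) (x : Fin (H + 1) → S) :
    episodeMeasure M H {ξ | path π ξ = x} =
      M.μ (x 0) * ∏ h : Fin H, M.P (x h.castSucc) (π (x h.castSucc)) (x h.succ) := by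
  classical
  have : {ξ : EpisodeNoise S A H | path π ξ = x} = {x 0} ×ˢ (Set.univ.pi fun h : Fin H =>
      Set.univ.pi fun s => Set.univ.pi fun a =>
        if s = x h.castSucc ∧ a = π (x h.castSucc) then {x h.succ} else Set.univ) := by
    ext ξ
    simp only [Set.mem_ofPred_eq, path_eq_iff, Set.mem_prod, Set.mem_singleton_iff, Set.mem_pi,
      Set.mem_univ, forall_true_left]
    refine and_congr_right fun _ => forall_congr' fun h => ?_
    constructor
    · intro e s a
      split_ifs with c
      · rw [c.1, c.2]; exact e
      · trivial
    · intro e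
      simpa using e (x h.castSucc) (π (x h.castSucc))
  rw [this, episodeMeasure, Measure.prod_prod, Measure.pi_pi]
  congr 1
  · exact PMF.toMeasure_apply_singleton _ _ (MeasurableSet.singleton _)
  · refine Finset.prod_congr rfl fun h _ => ?_
    rw [Measure.pi_pi]
    simp_rw [Measure.pi_pi]
    rw [Finset.prod_eq_single (x h.castSucc), Finset.prod_eq_single (π (x h.castSucc))]
    · simp [PMF.toMeasure_apply_singleton _ _ (MeasurableSet.singleton _)]
    · intro a _ ha; simp [ha]
    · simp
    · intro s _ hs
      refine Finset.prod_eq_one fun a _ => ?_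
      simp [hs]
    · simp

/-! ### Replicable statistical queries -/

/-- The answer of the replicable statistical query procedure with accuracy `τ`, replicability
parameter `ρ` and failure parameter `δ` to the query `φ` on the sample `X`: the unit interval is cut
at the points `u * α + j * α` (`j` an integer), where `α = 2 τ / (ρ + 1 - 2 δ)` and `u * α` is a
random offset (`u` uniform in `[0, 1]`), and the answer is the midpoint of the piece that contains
the empirical mean of `φ`. -/
def rSTAT {X : Type*} (τ ρ δ : ℝ) (sample : Multiset X) (φ : X → ℝ) (u : unitInterval) : ℝ :=
  let α : ℝ := 2 * τ / (ρ + 1 - 2 * δ)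
  let off : ℝ := α * (u : ℝ)
  let v : ℝ := (sample.map φ).sum / (sample.card : ℝ)
  let j : ℤ := ⌊(v - off) / α⌋
  (max 0 (off + j * α) + min 1 (off + (j + 1) * α)) / 2

/-! ### The algorithm -/

/-- Parameters of the algorithm: accuracy `ε`, horizon `H`, number `m` of trajectories per
iteration, window `[k, k + w]` of the random threshold, maximum reward `Rmax`, and the parameters
`τSQ`, `ρSQ`, `δSQ` of the replicable statistical queries. -/
structure Params where
  ε : ℝ
  H : ℕ
  m : ℕ
  k : ℝ
  w : ℝ
  Rmax : ℝ
  τSQ : ℝ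
  ρSQ : ℝ
  δSQ : ℝ

/-- The data kept by the algorithm: the set `K` of known pairs, the counts `n(s, a)`, the multisets
`S[(s, a)]` of all next states observed from `(s, a)`, the current model and policy. -/
structure State (S A : Type*) where
  K : Set (S × A)
  n : S → A → ℝ
  obs : S → A → Multiset S
  model : Model S A
  policy : S → A

open Classical in
/-- Initially nothing is known, and every pair is modelled as a self-loop of maximum reward. -/
def State.init {S A : Type*} (Rmax : ℝ) (π₀ : S → A) : State S A where
  K := ∅
  n := fun _ _ => 0
  obs := fun _ _ => 0
  model :=
    { P := fun s _ s' => if s' = s then 1 else 0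
      r := fun _ _ => Rmax }
  policy := π₀

/-- The randomness of one iteration: that of `m` episodes, of the threshold, and of one statistical
query for every `(s, a, s')`. -/
abbrev RoundNoise (S A : Type*) (H m : ℕ) :=
  (Fin m → EpisodeNoise S A H) × unitInterval × (S → A → S → unitInterval)

/-- Independent episodes, and independent uniform variables for threshold and queries. -/
def roundMeasure {S A : Type*} [Fintype S] [Fintype A] [MeasurableSpace S] (M : MDP S A)
    (H m : ℕ) : Measure (RoundNoise S A H m) :=
  (Measure.pi fun _ => episodeMeasure M H).prod
    ((volume : Measure unitInterval).prod
      (Measure.pi fun _ => Measure.pi fun _ => Measure.pi fun _ =>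
        (volume : Measure unitInterval)))

instance {S A : Type*} [Fintype S] [Fintype A] [MeasurableSpace S] (M : MDP S A) (H m : ℕ) :
    IsProbabilityMeasure (roundMeasure M H m) := by
  unfold roundMeasure; infer_instance

section Algorithm

variable {S A : Type*}

open Classical in
/-- `ĉ_{s,a}`: the average number of visits to `(s, a)` in the sampled trajectories. -/
def avgVisits {H m : ℕ} (π : S → A) (ξ : Fin m → EpisodeNoise S A H) (s : S) (a : A) : ℝ :=
  (1 / (m : ℝ)) * ∑ j, ∑ h : Fin H,
    if path π (ξ j) h.castSucc = s ∧ π (path π (ξ j) h.castSucc) = a then (1 : ℝ) else 0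

open Classical in
/-- The multiset of next states observed from `(s, a)` in the sampled trajectories. -/
def nextStates {H m : ℕ} (π : S → A) (ξ : Fin m → EpisodeNoise S A H) (s : S) (a : A) :
    Multiset S :=
  ∑ j, ∑ h : Fin H,
    if path π (ξ j) h.castSucc = s ∧ π (path π (ξ j) h.castSucc) = a
    then {path π (ξ j) h.succ} else 0

open Classical in
/-- The counts after the call of the subroutine that updates the known set: only those of unknown
pairs are increased. -/
def newCount {H m : ℕ} (σ : State S A) (ξ : Fin m → EpisodeNoise S A H) (s : S) (a : A) : ℝ :=
  if (s, a) ∈ σ.K then σ.n s a else σ.n s a + avgVisits σ.policy ξ s a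

/-- The set `K_i` of pairs that become known in this iteration: the unknown pairs whose count has
reached the threshold `k' = k + w u`, which is uniform in `[k, k + w]`. -/
def newKnown {H m : ℕ} (k w : ℝ) (σ : State S A) (ξ : Fin m → EpisodeNoise S A H)
    (u : unitInterval) : Set (S × A) :=
  {p | p ∉ σ.K ∧ k + w * (u : ℝ) ≤ newCount σ ξ p.1 p.2}

open Classical in
/-- The updated model: for newly known pairs the transition probabilities are estimated by
replicable statistical queries for the indicators of the states `s'` on all next states observed so
far, and the reward is set to the true one. -/
def newModel {H m : ℕ} (M : MDP S A) (p : Params) (σ : State S A)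
    (ζ : RoundNoise S A H m) : Model S A where
  P s a s' :=
    if (s, a) ∈ newKnown p.k p.w σ ζ.1 ζ.2.1 then
      rSTAT p.τSQ p.ρSQ p.δSQ (σ.obs s a + nextStates σ.policy ζ.1 s a)
        (fun x => if x = s' then 1 else 0) (ζ.2.2 s a s')
    else σ.model.P s a s'
  r s a := if (s, a) ∈ newKnown p.k p.w σ ζ.1 ζ.2.1 then M.r s a else σ.model.r s a

variable [Fintype S] [Fintype A]

/-- One iteration of the body of the loop. The new policy is an optimal policy of the new model;
`tie` selects one among them. -/
def body {H m : ℕ} (M : MDP S A) (p : Params) (tie : Finset (S → A) → (S → A))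
    (σ : State S A) (ζ : RoundNoise S A H m) : State S A where
  K := σ.K ∪ newKnown p.k p.w σ ζ.1 ζ.2.1
  n := newCount σ ζ.1
  obs s a := σ.obs s a + nextStates σ.policy ζ.1 s a
  model := newModel M p σ ζ
  policy := tie ((newModel M p σ ζ).optimalPolicies M.γ)

/-- The randomness of a run: the initial policy and the randomness of all iterations. -/
abbrev RunNoise (S A : Type*) (H m : ℕ) := (S → A) × (ℕ → RoundNoise S A H m)

/-- The initial policy is drawn from `ν`; the iterations use independent randomness. -/
def runMeasure [MeasurableSpace S] [MeasurableSpace A] (M : MDP S A) (ν : PMF (S → A))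
    (H m : ℕ) : Measure (RunNoise S A H m) :=
  ν.toMeasure.prod (Measure.infinitePi fun _ : ℕ => roundMeasure M H m)

open Classical in
/-- The data after `i` iterations of the loop
"while the current policy is not `ε`-optimal, execute the body". -/
def run (M : MDP S A) (p : Params) (tie : Finset (S → A) → (S → A))
    (ω : RunNoise S A p.H p.m) : ℕ → State S A
  | 0 => State.init p.Rmax ω.1
  | i + 1 =>
    if M.IsEpsOptimal p.ε (run M p tie ω i).policy then run M p tie ω i
    else body M p tie (run M p tie ω i) (ω.2 i)

end Algorithm

instance {S A : Type*} [Fintype S] [Fintype A] [MeasurableSpace S] [MeasurableSpace A]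
    (M : MDP S A) (ν : PMF (S → A)) (H m : ℕ) : IsProbabilityMeasure (runMeasure M ν H m) := by
  unfold runMeasure; infer_instance

end RepRMax

end

/-! An `ε`-optimal policy is never replaced, so if the policy after `T` iterations fails, all `T`
iterations were executed with failing policies. In that case two estimates for the number of visits
to unknown pairs contradict each other, except on a rare event.

Upper estimate: the count of a pair stays below `k + w` while the pair is unknown, one iteration
adds at most `H`, and known pairs are frozen. The sum of all counts, which is exactly the sum of the
observed rates of unknown visits, is thus at most `|S||A|(2H + w) ≤ Tε/16`.

Lower estimate: the model that is exact on known pairs and treats unknown ones as self-loops of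
maximal reward dominates the true values, and exceeds them by at most the expected number of unknown
visits in `H` steps plus `γ ^ H`. A policy optimal for an accurate estimate of this model is
therefore `ε`-optimal unless it is expected to make at least `ε/8` unknown visits per episode
(`IsAccurate.isEpsOptimal`). A failing run has `T` such conditional means, and falling to `Tε/16` is
a large deviation.

Accuracy: a pair becomes known only after at least `mH` observations, so its empirical frequencies
are close to `P`, and a query adds an error of at most `τ` for every offset. Threshold and offsets
are handled deterministically; only the episodes need probability.

Both deviations are adaptive. They share one tool: the run is a chain driven by independent noise,
exponential factors with conditional expectation at most one have a product with expectation at most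
one (`lintegral_prod_chain_le_one`), and Markov's inequality gives the tail
(`runMeasure_sum_ge_le`). -/

noncomputable section

namespace RepRMax

/-! ### Markov chains driven by independent noise -/

/-- Hoeffding's lemma in exponential form. -/
theorem lintegral_exp_sub_le_one {Ω : Type*} [MeasurableSpace Ω] {μ : Measure Ω}
    [IsProbabilityMeasure μ] {X : Ω → ℝ} (hX : Measurable X) {a b : ℝ}
    (hab : ∀ ω, X ω ∈ Set.Icc a b) (t : ℝ) :
    ∫⁻ ω, ENNReal.ofReal (Real.exp (t * (X ω - ∫ ω', X ω' ∂μ) - t ^ 2 * (b - a) ^ 2 / 8)) ∂μ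
      ≤ 1 := by
  have hs := ProbabilityTheory.hasSubgaussianMGF_of_mem_Icc (μ := μ) hX.aemeasurable
    (Filter.Eventually.of_forall hab)
  have hm := hs.mgf_le t
  have hi := hs.integrable_exp_mul t
  simp_rw [Real.exp_sub, div_eq_mul_inv _ (Real.exp _)]
  rw [← ofReal_integral_eq_lintegral_ofReal (hi.mul_const _)
    (Filter.Eventually.of_forall fun _ => by positivity), ← ENNReal.ofReal_one]
  apply ENNReal.ofReal_le_ofReal
  rw [integral_mul_const, ← div_eq_mul_inv, div_le_one (Real.exp_pos _)]
  refine hm.trans (Real.exp_le_exp.2 (le_of_eq ?_))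
  push_cast
  rw [Real.norm_eq_abs, div_pow, sq_abs]
  ring

variable {X Z : Type*}

/-- The states of the chain which starts in `x` and is driven by the noise `ζ`. -/
def chain {n : ℕ} (step : X → Z → X) (x : X) (ζ : Fin n → Z) : Fin (n + 1) → X :=
  Fin.induction (motive := fun _ => X) x fun h s => step s (ζ h)

@[simp]
theorem chain_zero {n : ℕ} (step : X → Z → X) (x : X) (ζ : Fin n → Z) :
    chain step x ζ 0 = x := rfl

theorem chain_succ {n : ℕ} (step : X → Z → X) (x : X) (ζ : Fin n → Z) (h : Fin n) :
    chain step x ζ h.succ = step (chain step x ζ h.castSucc) (ζ h) := by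
  simp [chain]

/-- Peeling off the first noise variable, instead of the last, permits inductions over arbitrary
starting points with Fubini in place of conditional expectations. -/
theorem chain_succ_eq_tail {n : ℕ} (step : X → Z → X) (x : X) (ζ : Fin (n + 1) → Z)
    (i : Fin (n + 1)) :
    chain step x ζ i.succ = chain step (step x (ζ 0)) (fun j => ζ j.succ) i := by
  induction i using Fin.induction with
  | zero => rw [chain_succ]; simp
  | succ i ih => rw [chain_succ, chain_succ, ← ih]; rfl

variable [MeasurableSpace X] [MeasurableSpace Z]

theorem measurable_chain {n : ℕ} {step : X → Z → X} (hstep : Measurable (Function.uncurry step))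
    (i : Fin (n + 1)) :
    Measurable fun p : X × (Fin n → Z) => chain step p.1 p.2 i := by
  induction i using Fin.induction with
  | zero => exact measurable_fst
  | succ i ih =>
    simp_rw [chain_succ]
    exact hstep.comp (ih.prodMk ((measurable_pi_apply i).comp measurable_snd))

theorem lintegral_pi_fin_succ {n : ℕ} (κ : Measure Z) [SigmaFinite κ]
    {G : Z × (Fin n → Z) → ENNReal} (hG : Measurable G) :
    ∫⁻ ζ, G (ζ 0, fun j => ζ j.succ) ∂(Measure.pi fun _ : Fin (n + 1) => κ)
      = ∫⁻ z, ∫⁻ ζ, G (z, ζ) ∂(Measure.pi fun _ : Fin n => κ) ∂κ := by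
  have h := (measurePreserving_piFinSuccAbove (fun _ : Fin (n + 1) => κ) 0).lintegral_comp hG
  rw [lintegral_prod _ hG.aemeasurable] at h
  exact h

/-- If the conditional expectation of every factor is at most one, then so is the expectation of
the product along the chain. -/
theorem lintegral_prod_chain_le_one {n : ℕ} (κ : Measure Z) [IsProbabilityMeasure κ]
    {step : X → Z → X} (hstep : Measurable (Function.uncurry step))
    {F : X → Z → ENNReal} (hF : Measurable (Function.uncurry F))
    (h1 : ∀ x, ∫⁻ z, F x z ∂κ ≤ 1) (x : X) :
    ∫⁻ ζ, ∏ h : Fin n, F (chain step x ζ h.castSucc) (ζ h) ∂(Measure.pi fun _ : Fin n => κ)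
      ≤ 1 := by
  induction n generalizing x with
  | zero => simp
  | succ n ih =>
    -- With the first noise `z` fixed, the remaining factors form a product along the chain started
    -- in `step x z`. Its integral is at most one by induction, and the factor `F x z` integrates to
    -- at most one by `h1`.
    simp_rw [Fin.prod_univ_succ, ← Fin.succ_castSucc, chain_succ_eq_tail]
    have hm (h : Fin n) : Measurable fun p : Z × (Fin n → Z) =>
        F (chain step (step x p.1) p.2 h.castSucc) (p.2 h) := by
      refine hF.comp (Measurable.prodMk ?_ ((measurable_pi_apply h).comp measurable_snd))
      exact (measurable_chain hstep h.castSucc).comp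
        ((hstep.comp (measurable_const.prodMk measurable_fst)).prodMk measurable_snd)
    have h0 : Measurable fun z => F x z := hF.comp (measurable_const.prodMk measurable_id)
    have hG : Measurable fun p : Z × (Fin n → Z) =>
        F x p.1 * ∏ h : Fin n, F (chain step (step x p.1) p.2 h.castSucc) (p.2 h) :=
      (h0.comp measurable_fst).mul (Finset.measurable_fun_prod _ fun h _ => hm h)
    refine (lintegral_pi_fin_succ κ hG).trans_le ((lintegral_mono fun z => ?_).trans (h1 x))
    dsimp only
    rw [lintegral_const_mul]
    · exact mul_le_of_le_one_right' (ih _)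
    · exact Finset.measurable_fun_prod _ fun h _ => (hm h).comp (measurable_const.prodMk measurable_id)

/-- The first `n` coordinates of an independent sequence. -/
theorem measurePreserving_infinitePi_fin (κ : Measure Z) [IsProbabilityMeasure κ] (n : ℕ) :
    MeasurePreserving (fun (ω : ℕ → Z) (j : Fin n) => ω j)
      (Measure.infinitePi fun _ : ℕ => κ) (Measure.pi fun _ : Fin n => κ) := by
  have hmeas : Measurable fun (ω : ℕ → Z) (j : Fin n) => ω j :=
    measurable_pi_lambda _ fun j => measurable_pi_apply _
  refine ⟨hmeas, (Measure.pi_eq fun s hs => ?_).symm⟩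
  rw [Measure.map_apply hmeas (MeasurableSet.univ_pi hs)]
  let t : ℕ → Set Z := fun i => if h : i < n then s ⟨i, h⟩ else Set.univ
  have : (fun (ω : ℕ → Z) (j : Fin n) => ω j) ⁻¹' Set.univ.pi s
      = Set.pi (Finset.range n : Set ℕ) t := by
    ext ω
    simp only [Set.mem_preimage, Set.mem_pi, Set.mem_univ, forall_true_left, Finset.coe_range,
      Set.mem_Iio, t]
    constructor
    · intro h i hi
      simpa [hi] using h ⟨i, hi⟩
    · intro h i
      simpa using h i i.2
  rw [this, Measure.infinitePi_pi, Finset.prod_range]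
  · simp [t]
  · intro i hi
    have : i < n := by simpa using hi
    simpa [t, this] using hs _

/-! ### Values of discounted models -/

/-- Comparison principle for substochastic weights. -/
theorem nonneg_of_sum_le {S : Type*} [Fintype S] {W : S → S → ℝ} {f : S → ℝ} {q : ℝ}
    (hW : ∀ s s', 0 ≤ W s s') (hq : ∀ s, ∑ s', W s s' ≤ q) (hq1 : q < 1)
    (h : ∀ s, ∑ s', W s s' * f s' ≤ f s) (s : S) : 0 ≤ f s := by
  obtain ⟨s₀, -, hs₀⟩ := Finset.exists_min_image Finset.univ f ⟨s, Finset.mem_univ s⟩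
  refine le_trans ?_ (hs₀ s (Finset.mem_univ s))
  by_contra! hneg
  -- At a minimum `s₀` all terms can be replaced by `f s₀`. A negative minimum would be scaled by a
  -- row sum at most `q < 1` and so strictly increase.
  have h1 : (∑ s', W s₀ s') * f s₀ ≤ f s₀ := by
    rw [Finset.sum_mul]
    exact (Finset.sum_le_sum fun s' hs' =>
      mul_le_mul_of_nonneg_left (hs₀ s' hs') (hW _ _)).trans (h s₀)
  nlinarith [hq s₀]

namespace Model

variable {S A : Type*} [Fintype S]

/-- Nonnegative weights whose discounted row sums are bounded by a number below one. -/
structure IsContracting (M : Model S A) (γ q : ℝ) : Prop where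
  P_nonneg : ∀ s a s', 0 ≤ M.P s a s'
  sum_le : ∀ s a, γ * ∑ s', M.P s a s' ≤ q
  γ_nonneg : 0 ≤ γ
  lt_one : q < 1

variable {M : Model S A} {γ q : ℝ}

theorem IsContracting.nonneg (h : M.IsContracting γ q) (π : S → A) {f : S → ℝ}
    (hf : ∀ s, γ * ∑ s', M.P s (π s) s' * f s' ≤ f s) (s : S) : 0 ≤ f s := by
  refine nonneg_of_sum_le (W := fun s s' => γ * M.P s (π s) s')
    (fun s s' => mul_nonneg h.γ_nonneg (h.P_nonneg _ _ _)) (fun s => ?_) h.lt_one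
    (fun s => ?_) s
  · rw [← Finset.mul_sum]; exact h.sum_le s _
  · simp_rw [mul_assoc]
    rw [← Finset.mul_sum]; exact hf s

theorem IsContracting.abs_rewardAt_le (h : M.IsContracting γ q) {R : ℝ} (π : S → A)
    (hR : ∀ s a, |M.r s a| ≤ R) (t : ℕ) (s : S) :
    |γ ^ t * M.rewardAt π t s| ≤ q ^ t * R := by
  have hq : 0 ≤ q := le_trans
    (mul_nonneg h.γ_nonneg (Finset.sum_nonneg fun s' _ => h.P_nonneg s (π s) s')) (h.sum_le s (π s))
  induction t generalizing s with
  | zero => simpa [rewardAt] using hR s (π s)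
  | succ t ih =>
    rw [rewardAt, pow_succ', mul_assoc, Finset.mul_sum, abs_mul, abs_of_nonneg h.γ_nonneg]
    have h1 : |∑ s', γ ^ t * (M.P s (π s) s' * M.rewardAt π t s')|
        ≤ ∑ s', M.P s (π s) s' * (q ^ t * R) := by
      refine (Finset.abs_sum_le_sum_abs _ _).trans (Finset.sum_le_sum fun s' _ => ?_)
      rw [mul_left_comm, abs_mul, abs_of_nonneg (h.P_nonneg _ _ _)]
      exact mul_le_mul_of_nonneg_left (ih s') (h.P_nonneg _ _ _)
    refine (mul_le_mul_of_nonneg_left h1 h.γ_nonneg).trans ?_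
    rw [← Finset.sum_mul, ← mul_assoc, pow_succ', mul_assoc q]
    have : 0 ≤ R := (abs_nonneg _).trans (hR s (π s))
    exact mul_le_mul_of_nonneg_right (h.sum_le s (π s)) (by positivity)

/-- The Bellman equation. -/
theorem IsContracting.value_eq (h : M.IsContracting γ q) (π : S → A) (s : S) :
    M.value γ π s = M.r s (π s) + γ * ∑ s', M.P s (π s) s' * M.value γ π s' := by
  have hq : 0 ≤ q := le_trans
    (mul_nonneg h.γ_nonneg (Finset.sum_nonneg fun s' _ => h.P_nonneg s (π s) s')) (h.sum_le s (π s))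
  have hsum (s : S) : Summable fun t : ℕ => γ ^ t * M.rewardAt π t s := by
    -- There may be infinitely many actions with unbounded rewards. Only those chosen by `π` matter,
    -- so the rewards are made independent of the action to obtain a uniform bound.
    let N : Model S A := ⟨M.P, fun s _ => M.r s (π s)⟩
    have hN : N.IsContracting γ q := ⟨h.1, h.2, h.3, h.4⟩
    have hr (t : ℕ) (s : S) : N.rewardAt π t s = M.rewardAt π t s := by
      induction t generalizing s with
      | zero => rfl
      | succ t ih => simp only [rewardAt, ih]; rfl
    have hb := hN.abs_rewardAt_le (R := ∑ s, |M.r s (π s)|) π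
      (fun s _ => Finset.single_le_sum (f := fun s => |M.r s (π s)|)
        (fun _ _ => abs_nonneg _) (Finset.mem_univ s))
    simp_rw [hr] at hb
    exact Summable.of_norm_bounded ((summable_geometric_of_lt_one hq h.lt_one).mul_right _)
      fun t => hb t s
  rw [value, (hsum s).tsum_eq_zero_add]
  simp only [pow_zero, one_mul, rewardAt, value]
  congr 1
  simp_rw [← tsum_mul_left]
  rw [← Summable.tsum_finsetSum (fun s' _ => (hsum s').mul_left _), ← tsum_mul_left]
  congr 1 with t
  rw [Finset.mul_sum, Finset.mul_sum]
  exact Finset.sum_congr rfl fun s' _ => by ring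

/-- A contracting model has an optimal policy. -/
theorem IsContracting.exists_isOptimal [Finite A] [Nonempty A] (h : M.IsContracting γ q) :
    ∃ π, M.IsOptimal γ π := by
  classical
  -- Maximizing the sum of the values suffices: a profitable one-step deviation would raise the
  -- value at one state without lowering any other (policy improvement).
  obtain ⟨π, hπ⟩ := Finite.exists_max fun π : S → A => ∑ s, M.value γ π s
  have key (s : S) (a : A) :
      M.r s a + γ * ∑ s', M.P s a s' * M.value γ π s' ≤ M.value γ π s := by
    by_contra! hlt
    have hv := h.value_eq π
    have hw := h.value_eq (Function.update π s a)
    -- The gain of the modified policy solves a Bellman equation whose only source is the advantage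
    -- of `a` at `s`; the comparison principle makes the gain nonnegative.
    have hstep (x : S) : γ * ∑ s', M.P x (Function.update π s a x) s' *
        (M.value γ (Function.update π s a) s' - M.value γ π s') +
          (if x = s then M.r s a + γ * ∑ s', M.P s a s' * M.value γ π s' - M.value γ π s else 0)
        = M.value γ (Function.update π s a) x - M.value γ π x := by
      simp_rw [mul_sub, Finset.sum_sub_distrib]
      rw [hw x]
      by_cases hx : x = s
      · subst hx
        simp only [Function.update_self, if_true]
        ring
      · simp only [Function.update_of_ne hx, hx, if_false]
        linarith [hv x]
    have hnn := h.nonneg (Function.update π s a)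
      (f := fun x => M.value γ (Function.update π s a) x - M.value γ π x) fun x => by
        rw [← hstep x]
        split_ifs
        · linarith
        · linarith
    have hs := hstep s
    have h0 : 0 ≤ γ * ∑ s', M.P s (Function.update π s a s) s' *
        (M.value γ (Function.update π s a) s' - M.value γ π s') :=
      mul_nonneg h.γ_nonneg (Finset.sum_nonneg fun s' _ =>
        mul_nonneg (h.P_nonneg _ _ _) (hnn s'))
    rw [if_pos rfl] at hs
    have : ∑ x, M.value γ π x < ∑ x, M.value γ (Function.update π s a) x :=
      Finset.sum_lt_sum (fun x _ => sub_nonneg.1 (hnn x)) ⟨s, Finset.mem_univ s, by linarith⟩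
    exact absurd (hπ _) (not_le.2 this)
  refine ⟨π, fun π' s => sub_nonneg.1 ?_⟩
  refine h.nonneg π' (f := fun s => M.value γ π s - M.value γ π' s) (fun s => ?_) s
  simp_rw [mul_sub, Finset.sum_sub_distrib]
  linarith [key s (π' s), h.value_eq π' s]

end Model

/-! ### The optimistic model: optimism, exploration and simulation error -/

namespace MDP

variable {S A : Type*} [Fintype S]

theorem sum_toReal (p : PMF S) : ∑ s, (p s).toReal = 1 := by
  rw [← ENNReal.toReal_sum fun s _ => p.apply_ne_top s, ← tsum_fintype (L := .unconditional S), p.tsum_coe,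
    ENNReal.toReal_one]

theorem isContracting (M : MDP S A) : M.toModel.IsContracting M.γ M.γ :=
  ⟨fun _ _ _ => ENNReal.toReal_nonneg, fun s a => by simp [toModel, sum_toReal], M.γ_nonneg,
    M.γ_lt_one⟩

open Classical in
/-- The model with the true dynamics on the pairs in `K`; every other pair is a self-loop of
reward `R`. -/
def optimistic (M : MDP S A) (K : Set (S × A)) (R : ℝ) : Model S A where
  P s a s' := if (s, a) ∈ K then (M.P s a s').toReal else if s' = s then 1 else 0
  r s a := if (s, a) ∈ K then M.r s a else R

theorem optimistic_sum_mul_of_notMem (M : MDP S A) {K : Set (S × A)} (R : ℝ) {s : S} {a : A}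
    (h : (s, a) ∉ K) (f : S → ℝ) : ∑ s', (M.optimistic K R).P s a s' * f s' = f s := by
  rw [Finset.sum_eq_single s]
  · simp [optimistic, h]
  · intro s' _ hs
    simp [optimistic, h, hs]
  · simp

theorem optimistic_sum (M : MDP S A) (K : Set (S × A)) (R : ℝ) (s : S) (a : A) :
    ∑ s', (M.optimistic K R).P s a s' = 1 := by
  by_cases h : (s, a) ∈ K
  · simp [optimistic, h, sum_toReal]
  · simpa using M.optimistic_sum_mul_of_notMem R h fun _ => 1

theorem optimistic_isContracting (M : MDP S A) (K : Set (S × A)) (R : ℝ) :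
    (M.optimistic K R).IsContracting M.γ M.γ := by
  refine ⟨fun s a s' => ?_, fun s a => by rw [optimistic_sum, mul_one], M.γ_nonneg, M.γ_lt_one⟩
  simp only [optimistic]
  split_ifs <;> simp

variable {M : MDP S A} {K : Set (S × A)} {R : ℝ}

theorem optimistic_r_mem {S A : Type*} {M : MDP S A} {K : Set (S × A)} {R : ℝ}
    (hr : ∀ s a, 0 ≤ M.r s a ∧ M.r s a ≤ R) (s : S) (a : A) :
    0 ≤ (M.optimistic K R).r s a ∧ (M.optimistic K R).r s a ≤ R := by
  simp only [optimistic]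
  split_ifs
  · exact hr s a
  · exact ⟨(hr s a).1.trans (hr s a).2, le_rfl⟩

theorem optimistic_value_nonneg (hr : ∀ s a, 0 ≤ M.r s a ∧ M.r s a ≤ R) (π : S → A) (s : S) :
    0 ≤ (M.optimistic K R).value M.γ π s := by
  have h := M.optimistic_isContracting K R
  refine h.nonneg π (fun s => ?_) s
  linarith [h.value_eq π s, (optimistic_r_mem (K := K) hr s (π s)).1]

theorem optimistic_value_le_one (hr : ∀ s a, 0 ≤ M.r s a ∧ M.r s a ≤ R) (hR : R ≤ 1 - M.γ)
    (π : S → A) (s : S) : (M.optimistic K R).value M.γ π s ≤ 1 := by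
  have h := M.optimistic_isContracting K R
  refine sub_nonneg.1 (h.nonneg π (f := fun s => 1 - (M.optimistic K R).value M.γ π s)
    (fun s => ?_) s)
  simp_rw [mul_sub, Finset.sum_sub_distrib, mul_one, M.optimistic_sum]
  linarith [h.value_eq π s, (optimistic_r_mem (K := K) hr s (π s)).2]

theorem value_nonneg (hr : ∀ s a, 0 ≤ M.r s a ∧ M.r s a ≤ R) (π : S → A) (s : S) :
    0 ≤ M.toModel.value M.γ π s := by
  have h := M.isContracting
  refine h.nonneg π (fun s => ?_) s
  have : 0 ≤ M.toModel.r s (π s) := (hr s (π s)).1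
  linarith [h.value_eq π s]

theorem optimistic_value_of_notMem {π : S → A} {s : S} (hs : (s, π s) ∉ K) :
    (1 - M.γ) * (M.optimistic K R).value M.γ π s = R := by
  have h := (M.optimistic_isContracting K R).value_eq π s
  rw [optimistic_sum_mul_of_notMem M R hs] at h
  have : (M.optimistic K R).r s (π s) = R := by simp [optimistic, hs]
  linarith

/-- Optimism: on `K` both values satisfy the same Bellman equation, and off `K` the self-loop earns
`R / (1 - γ)`, the largest value possible. The comparison principle does the rest. -/
theorem value_le_optimistic (hr : ∀ s a, 0 ≤ M.r s a ∧ M.r s a ≤ R) (π : S → A) (s : S) :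
    M.toModel.value M.γ π s ≤ (M.optimistic K R).value M.γ π s := by
  have hγ := M.γ_lt_one
  have hbound (s : S) : (1 - M.γ) * M.toModel.value M.γ π s ≤ R := by
    have h := M.isContracting
    refine sub_nonneg.1 (h.nonneg π (f := fun s => R - (1 - M.γ) * M.toModel.value M.γ π s)
      (fun s => ?_) s)
    have h1 : ∑ s', M.toModel.P s (π s) s' = 1 := sum_toReal _
    have h2 := h.value_eq π s
    have h3 : M.toModel.r s (π s) ≤ R := (hr s (π s)).2
    simp_rw [mul_sub, Finset.sum_sub_distrib, mul_left_comm _ (1 - M.γ), ← Finset.mul_sum,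
      ← Finset.sum_mul, h1]
    nlinarith
  have h := M.optimistic_isContracting K R
  refine sub_nonneg.1 (h.nonneg π (f := fun s =>
    (M.optimistic K R).value M.γ π s - M.toModel.value M.γ π s) (fun s => ?_) s)
  by_cases hs : (s, π s) ∈ K
  · have h1 := h.value_eq π s
    have h2 := M.isContracting.value_eq π s
    simp only [optimistic, hs, if_true, toModel] at h1 h2 ⊢
    simp_rw [mul_sub, Finset.sum_sub_distrib, mul_sub]
    linarith
  · have h1 := optimistic_value_of_notMem (M := M) (R := R) hs
    have h2 := hbound s
    have h3 : 0 ≤ (M.optimistic K R).value M.γ π s - M.toModel.value M.γ π s := by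
      by_contra! hlt
      nlinarith
    rw [optimistic_sum_mul_of_notMem M R hs]
    nlinarith [M.γ_nonneg]

open Classical in
/-- Expected number of visits of `π` to pairs outside `K` in the first `h` steps from `s`. -/
def expVisits (M : MDP S A) (K : Set (S × A)) (π : S → A) : ℕ → S → ℝ
  | 0, _ => 0
  | h + 1, s => (if (s, π s) ∈ K then 0 else 1) +
      ∑ s', (M.P s (π s) s').toReal * expVisits M K π h s'

theorem expVisits_nonneg (π : S → A) (h : ℕ) (s : S) : 0 ≤ M.expVisits K π h s := by
  induction h generalizing s with
  | zero => exact le_rfl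
  | succ h ih =>
    exact add_nonneg (by split_ifs <;> simp)
      (Finset.sum_nonneg fun s' _ => mul_nonneg ENNReal.toReal_nonneg (ih s'))

theorem one_le_expVisits {π : S → A} {h : ℕ} (hh : 0 < h) {s : S} (hs : (s, π s) ∉ K) :
    1 ≤ M.expVisits K π h s := by
  obtain ⟨h, rfl⟩ := Nat.exists_eq_succ_of_ne_zero hh.ne'
  simp only [expVisits, hs, if_false]
  have : 0 ≤ ∑ s', (M.P s (π s) s').toReal * M.expVisits K π h s' :=
    Finset.sum_nonneg fun s' _ => mul_nonneg ENNReal.toReal_nonneg (expVisits_nonneg _ _ _)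
  linarith

/-- The optimistic model overestimates a policy by at most the expected number of visits to
unknown pairs, up to the tail of the discounted sum. -/
theorem optimistic_value_sub_le (hr : ∀ s a, 0 ≤ M.r s a ∧ M.r s a ≤ R) (hR : R ≤ 1 - M.γ)
    (π : S → A) (h : ℕ) (s : S) :
    (M.optimistic K R).value M.γ π s - M.toModel.value M.γ π s
      ≤ M.expVisits K π h s + M.γ ^ h := by
  have hone (s : S) : (M.optimistic K R).value M.γ π s - M.toModel.value M.γ π s ≤ 1 := by
    linarith [value_nonneg hr π s, optimistic_value_le_one (K := K) hr hR π s]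
  have hγ := M.γ_nonneg
  induction h generalizing s with
  | zero => simpa [expVisits] using hone s
  | succ h ih =>
    -- A known pair has the same reward and row in both models, so the gap propagates by one
    -- discounted step. At an unknown pair the gap is at most one, and this visit already counts
    -- one.
    by_cases hs : (s, π s) ∈ K
    · have h1 := (M.optimistic_isContracting K R).value_eq π s
      have h2 := M.isContracting.value_eq π s
      simp only [optimistic, hs, if_true, toModel] at h1 h2
      simp only [expVisits, hs, if_true, zero_add]
      have h3 : ∑ s', (M.P s (π s) s').toReal *
          ((M.optimistic K R).value M.γ π s' - M.toModel.value M.γ π s')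
          ≤ ∑ s', (M.P s (π s) s').toReal * M.expVisits K π h s' + M.γ ^ h := by
        calc _ ≤ ∑ s', (M.P s (π s) s').toReal * (M.expVisits K π h s' + M.γ ^ h) :=
              Finset.sum_le_sum fun s' _ => mul_le_mul_of_nonneg_left (ih s') ENNReal.toReal_nonneg
          _ = _ := by
              simp_rw [mul_add, Finset.sum_add_distrib, ← Finset.sum_mul, sum_toReal, one_mul]
      have h4 : 0 ≤ ∑ s', (M.P s (π s) s').toReal * M.expVisits K π h s' :=
        Finset.sum_nonneg fun s' _ => mul_nonneg ENNReal.toReal_nonneg (expVisits_nonneg _ _ _)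
      simp_rw [mul_sub, Finset.sum_sub_distrib] at h3
      simp only [optimistic, toModel] at h3 ⊢
      rw [pow_succ']
      nlinarith [M.γ_lt_one]
    · have := one_le_expVisits (M := M) (Nat.succ_pos h) hs
      linarith [hone s, pow_nonneg hγ (h + 1)]

/-- A model which is exact outside `K` and has accuracy `e` on `K`. -/
structure IsAccurate (M : MDP S A) (K : Set (S × A)) (R e : ℝ) (N : Model S A) : Prop where
  P_nonneg : ∀ s a s', 0 ≤ N.P s a s'
  r_eq : ∀ s a, N.r s a = (M.optimistic K R).r s a
  P_eq : ∀ s a, (s, a) ∉ K → ∀ s', N.P s a s' = (M.optimistic K R).P s a s'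
  abs_sub_le : ∀ s a, (s, a) ∈ K → ∀ s', |N.P s a s' - (M.P s a s').toReal| ≤ e

variable {N : Model S A} {e ε : ℝ}

theorem IsAccurate.sum_abs_le (h : M.IsAccurate K R e N) (he : 0 ≤ e) (s : S) (a : A) :
    ∑ s', |N.P s a s' - (M.optimistic K R).P s a s'| ≤ Fintype.card S * e := by
  rw [← nsmul_eq_mul]
  refine Finset.sum_le_card_nsmul _ _ _ fun s' _ => ?_
  by_cases hs : (s, a) ∈ K
  · simpa [optimistic, hs] using h.abs_sub_le s a hs s'
  · simpa [h.P_eq s a hs s'] using he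

/-- Estimated rows may sum to as much as `1 + |S| e`, so the discount must absorb this excess. -/
theorem IsAccurate.isContracting (h : M.IsAccurate K R e N) (he : 0 ≤ e)
    (hlt : M.γ * (1 + Fintype.card S * e) < 1) :
    N.IsContracting M.γ (M.γ * (1 + Fintype.card S * e)) := by
  refine ⟨h.P_nonneg, fun s a => mul_le_mul_of_nonneg_left ?_ M.γ_nonneg, M.γ_nonneg, hlt⟩
  rw [← M.optimistic_sum K R s a, ← sub_le_iff_le_add', ← Finset.sum_sub_distrib]
  exact (Finset.sum_le_sum fun s' _ => le_abs_self _).trans (h.sum_abs_le he s a)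

/-- Simulation lemma. -/
theorem IsAccurate.abs_value_sub_le (h : M.IsAccurate K R e N) (he : 0 ≤ e)
    (hlt : M.γ * (1 + Fintype.card S * e) < 1)
    (hr : ∀ s a, 0 ≤ M.r s a ∧ M.r s a ≤ R) (hR : R ≤ 1 - M.γ) {D : ℝ}
    (hD : M.γ * (Fintype.card S * e) ≤ D * (1 - M.γ * (1 + Fintype.card S * e)))
    (hD0 : 0 ≤ D) (π : S → A) (s : S) :
    |N.value M.γ π s - (M.optimistic K R).value M.γ π s| ≤ D := by
  have hc := h.isContracting he hlt
  have ho := M.optimistic_isContracting K R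
  -- The difference solves a Bellman equation for `N` with a source of size at most `γ |S| e`, since
  -- the optimistic values lie in `[0, 1]`. By `hD` the constant `D` is a supersolution, so
  -- comparison applies to `D` plus and minus the difference.
  have hdiff (s : S) : N.value M.γ π s - (M.optimistic K R).value M.γ π s =
      M.γ * ∑ s', N.P s (π s) s' * (N.value M.γ π s' - (M.optimistic K R).value M.γ π s') +
      M.γ * ∑ s', (N.P s (π s) s' - (M.optimistic K R).P s (π s) s') *
        (M.optimistic K R).value M.γ π s' := by
    rw [hc.value_eq π s, ho.value_eq π s, h.r_eq]
    simp_rw [mul_sub, sub_mul, Finset.sum_sub_distrib]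
    ring
  have herr (s : S) : |M.γ * ∑ s', (N.P s (π s) s' - (M.optimistic K R).P s (π s) s') *
        (M.optimistic K R).value M.γ π s'| ≤ M.γ * (Fintype.card S * e) := by
    rw [abs_mul, abs_of_nonneg M.γ_nonneg]
    refine mul_le_mul_of_nonneg_left ?_ M.γ_nonneg
    refine (Finset.abs_sum_le_sum_abs _ _).trans
      ((Finset.sum_le_sum fun s' _ => ?_).trans (h.sum_abs_le he s (π s)))
    rw [abs_mul]
    refine mul_le_of_le_one_right (abs_nonneg _) ?_
    rw [abs_of_nonneg (optimistic_value_nonneg hr π s')]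
    exact optimistic_value_le_one hr hR π s'
  have hrow (s : S) : M.γ * ∑ s', N.P s (π s) s' * D
      ≤ D * (M.γ * (1 + Fintype.card S * e)) := by
    rw [← Finset.sum_mul, ← mul_assoc, mul_comm D]
    exact mul_le_mul_of_nonneg_right (hc.sum_le s (π s)) hD0
  rw [abs_le]
  constructor
  · refine neg_le_iff_add_nonneg.2 (hc.nonneg π (f := fun s =>
      N.value M.γ π s - (M.optimistic K R).value M.γ π s + D) (fun s => ?_) s)
    simp only [mul_add, Finset.sum_add_distrib]
    linarith [hdiff s, hrow s, (abs_le.1 (herr s)).1]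
  · refine sub_nonneg.1 (hc.nonneg π (f := fun s =>
      D - (N.value M.γ π s - (M.optimistic K R).value M.γ π s)) (fun s => ?_) s)
    simp only [mul_sub _ D, Finset.sum_sub_distrib]
    linarith [hdiff s, hrow s, (abs_le.1 (herr s)).2]

/-- The expected number of visits to unknown pairs controls the suboptimality of an optimal policy
of an accurate model. -/
theorem IsAccurate.isEpsOptimal (h : M.IsAccurate K R e N) (hε : 0 < ε) (hε1 : ε < 1)
    (he : 0 ≤ e) (hSe : Fintype.card S * e ≤ 5 / 8 * (ε * (1 - M.γ) ^ 2))
    (hr : ∀ s a, 0 ≤ M.r s a ∧ M.r s a ≤ R) (hR : R ≤ 1 - M.γ) {H : ℕ}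
    (hH : M.γ ^ H ≤ ε / 2) {π : S → A} (hπ : N.IsOptimal M.γ π)
    (hv : ∑ s, (M.μ s).toReal * M.expVisits K π H s ≤ ε / 8) : M.IsEpsOptimal ε π := by
  have hγ0 := M.γ_nonneg
  have hγ1 := M.γ_lt_one
  have hb0 : 0 ≤ Fintype.card S * e := by positivity
  set x := 1 - M.γ with hx
  set b := Fintype.card S * e
  have hγx : M.γ * x ≤ 1 / 4 := by nlinarith [sq_nonneg (M.γ - 1 / 2)]
  have hγb : M.γ * b ≤ 5 / 32 * (ε * x) := by
    calc M.γ * b ≤ M.γ * (5 / 8 * (ε * x ^ 2)) := mul_le_mul_of_nonneg_left hSe hγ0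
      _ = 5 / 8 * (M.γ * x) * (ε * x) := by ring
      _ ≤ 5 / 8 * (1 / 4) * (ε * x) := by
          have : 0 ≤ ε * x := by nlinarith
          nlinarith
      _ = _ := by ring
  have hεx : ε * x ≤ x := by nlinarith
  have hlt : M.γ * (1 + b) < 1 := by nlinarith
  -- The second factor on the right is at least `27/32 * x`, and `3/16 * 27/32 = 81/512` just
  -- exceeds `5/32 = 80/512`.
  have hD : M.γ * b ≤ 3 / 16 * ε * (1 - M.γ * (1 + b)) := by nlinarith
  have hsim := h.abs_value_sub_le he hlt hr hR hD (by positivity)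
  intro π'
  -- The `7/8` consists of two simulation errors `3/16` and the tail `γ ^ H ≤ ε / 2`; the remaining
  -- `ε / 8` is left for `hv`.
  have hpt (s : S) : M.toModel.value M.γ π' s
      ≤ M.toModel.value M.γ π s + (M.expVisits K π H s + 7 / 8 * ε) := by
    linarith [(abs_le.1 (hsim π' s)).1, (abs_le.1 (hsim π s)).2, hπ π' s,
      value_le_optimistic (K := K) hr π' s, optimistic_value_sub_le (K := K) hr hR π H s]
  have hsum : M.return_ π' ≤ ∑ s, (M.μ s).toReal *
      (M.toModel.value M.γ π s + (M.expVisits K π H s + 7 / 8 * ε)) :=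
    Finset.sum_le_sum fun s _ => mul_le_mul_of_nonneg_left (hpt s) ENNReal.toReal_nonneg
  simp_rw [mul_add, Finset.sum_add_distrib, ← Finset.sum_mul, sum_toReal] at hsum
  have : M.return_ π = ∑ s, (M.μ s).toReal * M.toModel.value M.γ π s := rfl
  linarith

end MDP

/-! ### Episodes -/

section Episodes

variable {S A : Type*} [Fintype S] [Fintype A] [MeasurableSpace S]

/-- The law of the answers of the generative model in one step. -/
def stepLaw (M : MDP S A) : Measure (S → A → S) :=
  Measure.pi fun s => Measure.pi fun a => (M.P s a).toMeasure

instance (M : MDP S A) : IsProbabilityMeasure (stepLaw M) := by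
  unfold stepLaw; infer_instance

theorem episodeMeasure_eq (M : MDP S A) (H : ℕ) :
    episodeMeasure M H = M.μ.toMeasure.prod (Measure.pi fun _ => stepLaw M) := rfl

theorem path_eq_chain {S A : Type*} {H : ℕ} (π : S → A) (ξ : EpisodeNoise S A H) :
    path π ξ = chain (fun s z => z s (π s)) ξ.1 ξ.2 := rfl

theorem measurePreserving_answer (M : MDP S A) (s : S) (a : A) :
    MeasurePreserving (fun z : S → A → S => z s a) (stepLaw M) (M.P s a).toMeasure :=
  (measurePreserving_eval (fun a => (M.P s a).toMeasure) a).comp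
    (measurePreserving_eval (fun s => Measure.pi fun a => (M.P s a).toMeasure) s)

variable [DiscreteMeasurableSpace S]

theorem integral_answer (M : MDP S A) (s : S) (a : A) (f : S → ℝ) :
    ∫ z, f (z s a) ∂(stepLaw M) = ∑ s', (M.P s a s').toReal * f s' := by
  have h := measurePreserving_answer M s a
  rw [← integral_map (φ := fun z : S → A → S => z s a) (f := f) h.measurable.aemeasurable
    (Measurable.of_discrete.aestronglyMeasurable), h.map_eq, PMF.integral_eq_sum]
  simp

instance episodes_discrete {H m : ℕ} : DiscreteMeasurableSpace (Fin m → EpisodeNoise S A H) :=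
  MeasurableSingletonClass.toDiscreteMeasurableSpace

/-! ### Visits to unknown pairs -/

open Classical in
/-- Number of visits to pairs outside `K` in an episode. -/
def unknownVisits {S A : Type*} {H : ℕ} (K : Set (S × A)) (π : S → A)
    (ξ : EpisodeNoise S A H) : ℝ :=
  ∑ h : Fin H, if (path π ξ h.castSucc, π (path π ξ h.castSucc)) ∈ K then 0 else 1

theorem unknownVisits_mem_Icc {S A : Type*} {H : ℕ} (K : Set (S × A)) (π : S → A)
    (ξ : EpisodeNoise S A H) : unknownVisits K π ξ ∈ Set.Icc (0 : ℝ) H := by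
  constructor
  · exact Finset.sum_nonneg fun h _ => by split_ifs <;> simp
  · refine (Finset.sum_le_card_nsmul _ _ 1 fun h _ => by split_ifs <;> simp).trans ?_
    simp

theorem integral_unknownVisits_start (M : MDP S A) (K : Set (S × A)) (π : S → A) (H : ℕ) (s : S) :
    ∫ ζ, unknownVisits K π ((s, ζ) : EpisodeNoise S A H) ∂(Measure.pi fun _ => stepLaw M)
      = M.expVisits K π H s := by
  classical
  induction H generalizing s with
  | zero => simp [unknownVisits, MDP.expVisits]
  | succ H ih =>
    have hsplit (ζ : Fin (H + 1) → S → A → S) :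
        unknownVisits K π ((s, ζ) : EpisodeNoise S A (H + 1)) =
          (if (s, π s) ∈ K then 0 else 1) +
            unknownVisits K π ((ζ 0 s (π s), fun j => ζ j.succ) : EpisodeNoise S A H) := by
      simp only [unknownVisits, path_eq_chain, Fin.sum_univ_succ, ← Fin.succ_castSucc,
        chain_succ_eq_tail]
      rfl
    simp_rw [hsplit]
    rw [integral_add (integrable_const _) Integrable.of_finite]
    rw [integral_const, probReal_univ, one_smul, MDP.expVisits]
    congr 1
    have hmp := measurePreserving_piFinSuccAbove (fun _ : Fin (H + 1) => stepLaw M) 0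
    have := hmp.integral_comp' (g := fun p : (S → A → S) × (Fin H → S → A → S) =>
      unknownVisits K π ((p.1 s (π s), p.2) : EpisodeNoise S A H))
    refine this.trans ?_
    rw [integral_prod _ Integrable.of_finite]
    simp_rw [ih]
    exact integral_answer M s (π s) fun s' => M.expVisits K π H s'

theorem integral_unknownVisits (M : MDP S A) (K : Set (S × A)) (π : S → A) (H : ℕ) :
    ∫ ξ, unknownVisits K π ξ ∂(episodeMeasure M H)
      = ∑ s, (M.μ s).toReal * M.expVisits K π H s := by
  rw [episodeMeasure_eq, integral_prod _ Integrable.of_finite]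
  simp_rw [integral_unknownVisits_start]
  rw [PMF.integral_eq_sum]
  simp

open Classical in
/-- The visits to pairs outside `K`, averaged over the sampled episodes. -/
def unknownRate {S A : Type*} [Fintype S] [Fintype A] {H m : ℕ} (K : Set (S × A)) (π : S → A)
    (ξ : Fin m → EpisodeNoise S A H) : ℝ :=
  ∑ p : S × A, if p ∈ K then 0 else avgVisits π ξ p.1 p.2

/-- Double counting: every step of an episode visits exactly one pair. -/
theorem unknownRate_eq {S A : Type*} [Fintype S] [Fintype A] {H m : ℕ} (K : Set (S × A))
    (π : S → A) (ξ : Fin m → EpisodeNoise S A H) :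
    unknownRate K π ξ = (1 / (m : ℝ)) * ∑ j, unknownVisits K π (ξ j) := by
  classical
  have h1 (p : S × A) : (if p ∈ K then 0 else avgVisits π ξ p.1 p.2) =
      (1 / (m : ℝ)) * ∑ j, ∑ h : Fin H, if p = (path π (ξ j) h.castSucc,
        π (path π (ξ j) h.castSucc)) then (if p ∈ K then 0 else 1) else 0 := by
    by_cases hp : p ∈ K
    · simp [hp]
    · simp only [hp, if_false, avgVisits, Prod.ext_iff]
      simp only [eq_comm]
  simp_rw [unknownRate, h1, ← Finset.mul_sum]
  congr 1
  rw [Finset.sum_comm]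
  refine Finset.sum_congr rfl fun j _ => ?_
  rw [Finset.sum_comm]
  refine Finset.sum_congr rfl fun h _ => ?_
  simp

theorem unknownRate_mem_Icc {S A : Type*} [Fintype S] [Fintype A] {H m : ℕ} (hm : 0 < m)
    (K : Set (S × A)) (π : S → A) (ξ : Fin m → EpisodeNoise S A H) :
    unknownRate K π ξ ∈ Set.Icc (0 : ℝ) H := by
  have hm' : (0 : ℝ) < m := by exact_mod_cast hm
  rw [unknownRate_eq, one_div, inv_mul_eq_div]
  refine ⟨div_nonneg (Finset.sum_nonneg fun j _ => (unknownVisits_mem_Icc K π _).1) hm'.le, ?_⟩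
  rw [div_le_iff₀ hm']
  refine (Finset.sum_le_card_nsmul _ _ (H : ℝ) fun j _ => (unknownVisits_mem_Icc K π _).2).trans ?_
  simp [mul_comm]

theorem integral_unknownRate (M : MDP S A) {H m : ℕ} (hm : 0 < m) (K : Set (S × A))
    (π : S → A) :
    ∫ ξ, unknownRate K π ξ ∂(Measure.pi fun _ : Fin m => episodeMeasure M H)
      = ∑ s, (M.μ s).toReal * M.expVisits K π H s := by
  have hm' : (m : ℝ) ≠ 0 := by exact_mod_cast hm.ne'
  simp_rw [unknownRate_eq]
  rw [integral_const_mul, integral_finsetSum _ fun j _ => Integrable.of_finite]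
  have (j : Fin m) : ∫ ξ : Fin m → EpisodeNoise S A H, unknownVisits K π (ξ j)
      ∂(Measure.pi fun _ : Fin m => episodeMeasure M H)
      = ∑ s, (M.μ s).toReal * M.expVisits K π H s := by
    rw [← integral_unknownVisits]
    exact integral_comp_eval (μ := fun _ : Fin m => episodeMeasure M H) (i := j)
      (Measurable.of_discrete.aestronglyMeasurable (f := unknownVisits K π))
  simp [this, hm']

/-- Hoeffding's lemma is applied to the average as a single variable in `[0, H]`. Forgoing the gain
from averaging over `m` episodes is affordable because `T` is of order `H² log(1/δ) / ε²`. -/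
theorem lintegral_exp_unknownRate_le_one (M : MDP S A) {H m : ℕ} (hm : 0 < m) (K : Set (S × A))
    (π : S → A) (t : ℝ) :
    ∫⁻ ξ, ENNReal.ofReal (Real.exp (t * (unknownRate K π ξ -
        ∑ s, (M.μ s).toReal * M.expVisits K π H s) - t ^ 2 * (H : ℝ) ^ 2 / 8))
      ∂(Measure.pi fun _ : Fin m => episodeMeasure M H) ≤ 1 := by
  have h := lintegral_exp_sub_le_one (μ := Measure.pi fun _ : Fin m => episodeMeasure M H)
    (X := unknownRate K π) Measurable.of_discrete (unknownRate_mem_Icc hm K π) t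
  simpa only [integral_unknownRate M hm, sub_zero] using h

/-! ### Exponential moments of the observed next states -/

open Classical in
/-- The exponent of the supermartingale which controls the empirical frequency of `s'` in a
sample: `t` times the deviation of the number of occurrences from `q` times the sample size,
compensated by `t² / 8` per observation. -/
def deviation {S : Type*} (t q : ℝ) (s' : S) : Multiset S →+ ℝ :=
  Multiset.sumAddMonoidHom.comp
    (Multiset.mapAddMonoidHom fun x => t * ((if x = s' then 1 else 0) - q) - t ^ 2 / 8)

open Classical in
@[simp]
theorem deviation_singleton {S : Type*} (t q : ℝ) (s' x : S) :
    deviation t q s' {x} = t * ((if x = s' then 1 else 0) - q) - t ^ 2 / 8 := by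
  simp [deviation]

open Classical in
theorem deviation_apply {S : Type*} (t q : ℝ) (s' : S) (X : Multiset S) :
    deviation t q s' X = t * ((X.map fun x => if x = s' then (1 : ℝ) else 0).sum - q * X.card)
      - t ^ 2 / 8 * X.card := by
  induction X using Multiset.induction with
  | empty => simp
  | cons a X ih =>
    rw [← Multiset.singleton_add, map_add, ih, deviation_singleton]
    simp only [Multiset.map_add, Multiset.map_singleton, Multiset.sum_add, Multiset.sum_singleton,
      Multiset.card_add, Multiset.card_singleton]
    push_cast
    ring

/-- The answer in each step is independent of the current state, so a visit to `(s, a)` contributes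
a Hoeffding factor of range one and any other step the factor one. Compensating per observation
handles the random number of observations. -/
theorem lintegral_exp_deviation_episode_le_one (M : MDP S A) {H : ℕ} (π : S → A) (s : S) (a : A)
    (s' : S) (t : ℝ) (ξ₀ : S) :
    ∫⁻ ζ, ENNReal.ofReal (Real.exp (deviation t (M.P s a s').toReal s'
        (nextStates π (fun _ : Fin 1 => ((ξ₀, ζ) : EpisodeNoise S A H)) s a)))
      ∂(Measure.pi fun _ => stepLaw M) ≤ 1 := by
  classical
  let F : S → (S → A → S) → ENNReal := fun x z =>
    if x = s ∧ π x = a then ENNReal.ofReal (Real.exp (t * ((if z s a = s' then 1 else 0) -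
      (M.P s a s').toReal) - t ^ 2 / 8)) else 1
  have hF (x : S) : ∫⁻ z, F x z ∂(stepLaw M) ≤ 1 := by
    by_cases hx : x = s ∧ π x = a
    · have h := lintegral_exp_sub_le_one (μ := stepLaw M)
        (X := fun z : S → A → S => if z s a = s' then (1 : ℝ) else 0) Measurable.of_discrete
        (a := 0) (b := 1) (fun z => by split_ifs <;> simp) t
      have hsum : ∑ x, (M.P s a x).toReal * (if x = s' then (1 : ℝ) else 0)
          = (M.P s a s').toReal := by simp
      rw [integral_answer M s a fun x => if x = s' then (1 : ℝ) else 0, hsum] at h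
      simpa only [F, if_pos hx, sub_zero, one_pow, mul_one] using h
    · simp [F, hx]
  refine le_trans (le_of_eq ?_) (lintegral_prod_chain_le_one (n := H) (stepLaw M)
    (step := fun x (z : S → A → S) => z x (π x)) Measurable.of_discrete (F := F)
    Measurable.of_discrete hF ξ₀)
  refine lintegral_congr fun ζ => ?_
  simp only [nextStates, Finset.univ_unique, Finset.sum_singleton, map_sum, Real.exp_sum]
  rw [ENNReal.ofReal_prod_of_nonneg fun _ _ => (Real.exp_pos _).le]
  refine Finset.prod_congr rfl fun h _ => ?_
  simp only [path_eq_chain, chain_succ, F]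
  by_cases hx : chain (fun x (z : S → A → S) => z x (π x)) ξ₀ ζ h.castSucc = s ∧
      π (chain (fun x (z : S → A → S) => z x (π x)) ξ₀ ζ h.castSucc) = a
  · rw [if_pos hx, if_pos hx, deviation_singleton, hx.1, ← hx.2, hx.1]
  · rw [if_neg hx, if_neg hx]
    simp

theorem lintegral_exp_deviation_le_one (M : MDP S A) {H m : ℕ} (π : S → A) (s : S) (a : A)
    (s' : S) (t : ℝ) :
    ∫⁻ ξ, ENNReal.ofReal (Real.exp (deviation t (M.P s a s').toReal s' (nextStates π ξ s a)))
      ∂(Measure.pi fun _ : Fin m => episodeMeasure M H) ≤ 1 := by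
  let F : Unit → EpisodeNoise S A H → ENNReal := fun _ ξ =>
    ENNReal.ofReal (Real.exp (deviation t (M.P s a s').toReal s'
      (nextStates π (fun _ : Fin 1 => ξ) s a)))
  have hF (x : Unit) : ∫⁻ ξ, F x ξ ∂(episodeMeasure M H) ≤ 1 := by
    rw [episodeMeasure_eq, lintegral_prod _ Measurable.of_discrete.aemeasurable]
    refine (lintegral_mono fun ξ₀ => lintegral_exp_deviation_episode_le_one M π s a s' t ξ₀).trans ?_
    simp
  -- For a fixed policy the episodes are independent: a chain with a trivial state.
  refine le_trans (le_of_eq ?_) (lintegral_prod_chain_le_one (n := m) (episodeMeasure M H)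
    (step := fun _ _ => ()) Measurable.of_discrete (F := F) Measurable.of_discrete hF ())
  refine lintegral_congr fun ξ => ?_
  simp only [F]
  rw [← ENNReal.ofReal_prod_of_nonneg fun _ _ => (Real.exp_pos _).le, ← Real.exp_sum, ← map_sum]
  simp [nextStates]

end Episodes

/-! ### Measurability of the algorithm -/

section Measurability

variable {S A : Type*}

instance : MeasurableSpace (Multiset S) := ⊤

instance : DiscreteMeasurableSpace (Multiset S) := ⟨fun _ => trivial⟩

/-- The σ-algebra generated by the components, so that measurability of an iteration can be checked
componentwise. -/
instance [MeasurableSpace S] [MeasurableSpace A] : MeasurableSpace (State S A) :=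
  MeasurableSpace.comap
    (fun σ => (fun p => p ∈ σ.K, σ.n, σ.obs, σ.model.P, σ.model.r, σ.policy) :
      State S A → (S × A → Prop) × (S → A → ℝ) × (S → A → Multiset S) × (S → A → S → ℝ) ×
        (S → A → ℝ) × (S → A)) inferInstance

section Components

variable [MeasurableSpace S] [MeasurableSpace A] {Ω : Type*} [MeasurableSpace Ω]
  {σ : Ω → State S A}

theorem measurable_state (hK : ∀ p, MeasurableSet {ω | p ∈ (σ ω).K})
    (hn : ∀ s a, Measurable fun ω => (σ ω).n s a) (ho : ∀ s a, Measurable fun ω => (σ ω).obs s a)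
    (hP : ∀ s a s', Measurable fun ω => (σ ω).model.P s a s')
    (hr : ∀ s a, Measurable fun ω => (σ ω).model.r s a)
    (hp : Measurable fun ω => (σ ω).policy) : Measurable σ := by
  refine measurable_comap_iff.2 ?_
  exact (measurable_pi_lambda _ fun p => measurableSet_setOfPred.1 (hK p)).prodMk
    ((measurable_pi_lambda _ fun s => measurable_pi_lambda _ fun a => hn s a).prodMk
    ((measurable_pi_lambda _ fun s => measurable_pi_lambda _ fun a => ho s a).prodMk
    ((measurable_pi_lambda _ fun s => measurable_pi_lambda _ fun a =>
      measurable_pi_lambda _ fun s' => hP s a s').prodMk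
    ((measurable_pi_lambda _ fun s => measurable_pi_lambda _ fun a => hr s a).prodMk hp))))

theorem measurable_tuple (hσ : Measurable σ) : Measurable fun ω =>
    ((fun p => p ∈ (σ ω).K, (σ ω).n, (σ ω).obs, (σ ω).model.P, (σ ω).model.r, (σ ω).policy) :
      (S × A → Prop) × (S → A → ℝ) × (S → A → Multiset S) × (S → A → S → ℝ) ×
        (S → A → ℝ) × (S → A)) :=
  measurable_comap_iff.1 hσ

theorem measurableSet_mem_K (hσ : Measurable σ) (p : S × A) :
    MeasurableSet {ω | p ∈ (σ ω).K} :=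
  measurableSet_setOfPred.2 ((measurable_pi_apply p).comp (measurable_tuple hσ).fst)

theorem measurable_n (hσ : Measurable σ) (s : S) (a : A) : Measurable fun ω => (σ ω).n s a :=
  (measurable_pi_apply a).comp ((measurable_pi_apply s).comp (measurable_tuple hσ).snd.fst)

theorem measurable_obs (hσ : Measurable σ) (s : S) (a : A) : Measurable fun ω => (σ ω).obs s a :=
  (measurable_pi_apply a).comp ((measurable_pi_apply s).comp (measurable_tuple hσ).snd.snd.fst)

theorem measurable_model_P (hσ : Measurable σ) (s : S) (a : A) (s' : S) :
    Measurable fun ω => (σ ω).model.P s a s' :=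
  (measurable_pi_apply s').comp ((measurable_pi_apply a).comp
    ((measurable_pi_apply s).comp (measurable_tuple hσ).snd.snd.snd.fst))

theorem measurable_model_r (hσ : Measurable σ) (s : S) (a : A) :
    Measurable fun ω => (σ ω).model.r s a :=
  (measurable_pi_apply a).comp
    ((measurable_pi_apply s).comp (measurable_tuple hσ).snd.snd.snd.snd.fst)

theorem measurable_policy (hσ : Measurable σ) : Measurable fun ω => (σ ω).policy :=
  (measurable_tuple hσ).snd.snd.snd.snd.snd

end Components

section Model

variable [Fintype S] {Ω : Type*} [MeasurableSpace Ω] {N : Ω → Model S A}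

theorem measurable_value (hP : ∀ s a s', Measurable fun ω => (N ω).P s a s')
    (hr : ∀ s a, Measurable fun ω => (N ω).r s a) (γ : ℝ) (π : S → A) (s : S) :
    Measurable fun ω => (N ω).value γ π s := by
  have hrew (t : ℕ) (s : S) : Measurable fun ω => (N ω).rewardAt π t s := by
    induction t generalizing s with
    | zero => exact hr s _
    | succ t ih => exact Finset.measurable_fun_sum _ fun s' _ => (hP _ _ _).mul (ih s')
  exact Measurable.tsum fun t => (hrew t s).const_mul _

theorem measurable_tie_optimalPolicies [Fintype A] [MeasurableSpace S] [MeasurableSpace A]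
    (hP : ∀ s a s', Measurable fun ω => (N ω).P s a s')
    (hr : ∀ s a, Measurable fun ω => (N ω).r s a) (γ : ℝ) (tie : Finset (S → A) → (S → A)) :
    Measurable fun ω => tie ((N ω).optimalPolicies γ) := by
  classical
  have hopt : Measurable fun ω => fun π => (N ω).IsOptimal γ π := by
    refine measurable_pi_lambda _ fun π => measurableSet_setOfPred.1 ?_
    simp only [Model.IsOptimal, Set.ofPred_forall]
    exact MeasurableSet.iInter fun π' => MeasurableSet.iInter fun s =>
      measurableSet_le (measurable_value hP hr γ π' s) (measurable_value hP hr γ π s)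
  have : Measurable fun q : (S → A) → Prop => tie (Finset.univ.filter q) := Measurable.of_discrete
  exact this.comp hopt

end Model

theorem measurable_rSTAT [Countable S] (τ ρ δ : ℝ) (φ : S → ℝ) :
    Measurable fun p : Multiset S × unitInterval => rSTAT τ ρ δ p.1 φ p.2 := by
  -- Finite samples from a countable set are countably many, so only the dependence on the offset is
  -- at issue.
  refine measurable_from_prod_countable_right fun X => ?_
  have hj : Measurable fun u : unitInterval => ((⌊((X.map φ).sum / (X.card : ℝ) -
      2 * τ / (ρ + 1 - 2 * δ) * (u : ℝ)) / (2 * τ / (ρ + 1 - 2 * δ))⌋ : ℤ) : ℝ) :=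
    (measurable_from_top (f := fun j : ℤ => (j : ℝ))).comp
      ((((measurable_subtype_coe.const_mul _).const_sub _).div_const _).floor)
  have ho : Measurable fun u : unitInterval => 2 * τ / (ρ + 1 - 2 * δ) * (u : ℝ) :=
    measurable_subtype_coe.const_mul _
  exact ((measurable_const.max (ho.add (hj.mul_const _))).add
    (measurable_const.min (ho.add ((hj.add_const 1).mul_const _)))).div_const 2

variable [Fintype S] [Fintype A] [MeasurableSpace S] [DiscreteMeasurableSpace S]
  [MeasurableSpace A] [DiscreteMeasurableSpace A] {H m : ℕ}

theorem measurable_body (M : MDP S A) (p : Params) (tie : Finset (S → A) → (S → A)) :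
    Measurable (Function.uncurry (body (H := H) (m := m) M p tie)) := by
  have : DiscreteMeasurableSpace ((S → A) × (Fin m → EpisodeNoise S A H)) :=
    MeasurableSingletonClass.toDiscreteMeasurableSpace
  have hσ : Measurable fun x : State S A × RoundNoise S A H m => x.1 := measurable_fst
  have hpol : Measurable fun x : State S A × RoundNoise S A H m => (x.1.policy, x.2.1) :=
    (measurable_policy hσ).prodMk measurable_snd.fst
  have hn (s : S) (a : A) : Measurable fun x : State S A × RoundNoise S A H m =>
      newCount x.1 x.2.1 s a := by
    have h : Measurable fun q : (S → A) × (Fin m → EpisodeNoise S A H) =>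
      avgVisits q.1 q.2 s a := Measurable.of_discrete
    have h' := h.comp hpol
    have h0 := measurable_n hσ s a
    simp only [newCount]
    exact Measurable.ite (measurableSet_mem_K hσ (s, a)) h0 (h0.add h')
  have ho (s : S) (a : A) : Measurable fun x : State S A × RoundNoise S A H m =>
      x.1.obs s a + nextStates x.1.policy x.2.1 s a := by
    have h : Measurable fun q : (S → A) × (Fin m → EpisodeNoise S A H) =>
      nextStates q.1 q.2 s a := Measurable.of_discrete
    have hadd : Measurable fun q : Multiset S × Multiset S => q.1 + q.2 := Measurable.of_discrete
    have h' := h.comp hpol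
    have h'' := hadd.comp ((measurable_obs hσ s a).prodMk h')
    exact h''
  have hk (q : S × A) : MeasurableSet {x : State S A × RoundNoise S A H m |
      q ∈ newKnown p.k p.w x.1 x.2.1 x.2.2.1} :=
    (measurableSet_mem_K hσ q).compl.inter (measurableSet_le
      ((measurable_subtype_coe.comp measurable_snd.snd.fst).const_mul _ |>.const_add _)
      (hn q.1 q.2))
  have hP (s : S) (a : A) (s' : S) : Measurable fun x : State S A × RoundNoise S A H m =>
      (newModel M p x.1 x.2).P s a s' := by
    simp only [newModel]
    refine Measurable.ite (hk (s, a)) ?_ (measurable_model_P hσ s a s')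
    refine (measurable_rSTAT p.τSQ p.ρSQ p.δSQ _).comp ((ho s a).prodMk ?_)
    exact (measurable_pi_apply s').comp ((measurable_pi_apply a).comp
      ((measurable_pi_apply s).comp measurable_snd.snd.snd))
  have hr (s : S) (a : A) : Measurable fun x : State S A × RoundNoise S A H m =>
      (newModel M p x.1 x.2).r s a :=
    Measurable.ite (hk (s, a)) measurable_const (measurable_model_r hσ s a)
  exact measurable_state (fun q => (measurableSet_mem_K hσ q).union (hk q)) hn ho hP hr
    (measurable_tie_optimalPolicies hP hr M.γ tie)

end Measurability

/-! ### Concentration along a run -/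

theorem measurable_of_discrete_prod {X Y β : Type*} [MeasurableSpace X] [MeasurableSpace Y]
    [MeasurableSpace β] [Countable X] [Countable Y] [DiscreteMeasurableSpace X]
    [DiscreteMeasurableSpace Y] (f : X × Y → β) : Measurable f := Measurable.of_discrete

section Run

variable {S A : Type*} [Fintype S] [Fintype A]

open Classical in
/-- One pass through the loop, including the test of the loop condition. -/
def loopStep {H m : ℕ} (M : MDP S A) (p : Params) (tie : Finset (S → A) → (S → A))
    (σ : State S A) (ζ : RoundNoise S A H m) : State S A :=
  if M.IsEpsOptimal p.ε σ.policy then σ else body M p tie σ ζ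

variable {M : MDP S A} {p : Params} {tie : Finset (S → A) → (S → A)}
  {ω : RunNoise S A p.H p.m}

theorem run_succ (i : ℕ) :
    run M p tie ω (i + 1) = loopStep M p tie (run M p tie ω i) (ω.2 i) := rfl

theorem run_eq_chain (n : ℕ) (i : Fin (n + 1)) :
    run M p tie ω i
      = chain (loopStep M p tie) (State.init p.Rmax ω.1) (fun j : Fin n => ω.2 j) i := by
  induction i using Fin.induction with
  | zero => rfl
  | succ i ih => rw [chain_succ, ← ih]; rfl

/-- Being `ε`-optimal is absorbing because the loop then stops. -/
theorem not_isEpsOptimal_of_le {T i : ℕ} (hT : ¬ M.IsEpsOptimal p.ε (run M p tie ω T).policy)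
    (hi : i ≤ T) : ¬ M.IsEpsOptimal p.ε (run M p tie ω i).policy := by
  intro h
  refine hT ?_
  induction T, hi using Nat.le_induction with
  | base => exact h
  | succ T _ ih =>
    by_contra hT'
    by_cases ho : M.IsEpsOptimal p.ε (run M p tie ω T).policy
    · rw [run_succ, loopStep, if_pos ho] at hT'
      exact hT' ho
    · exact ho (ih ho)

variable [MeasurableSpace S] [DiscreteMeasurableSpace S] [MeasurableSpace A]
  [DiscreteMeasurableSpace A]

theorem measurable_loopStep {H m : ℕ} :
    Measurable (Function.uncurry (loopStep (H := H) (m := m) M p tie)) := by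
  have hopt : MeasurableSet {x : State S A × RoundNoise S A H m |
      M.IsEpsOptimal p.ε x.1.policy} :=
    (measurable_policy measurable_fst) (MeasurableSet.of_discrete (s := {π | M.IsEpsOptimal p.ε π}))
  exact Measurable.ite hopt measurable_fst (measurable_body M p tie)

/-- For a fixed initial policy, the first `n` rounds are independent and drive a chain of algorithm
states. Averaging over the initial policy preserves the bound. -/
theorem lintegral_prod_run_le_one {ν : PMF (S → A)}
    {F : State S A → RoundNoise S A p.H p.m → ENNReal} (hF : Measurable (Function.uncurry F))
    (h1 : ∀ σ, ∫⁻ ζ, F σ ζ ∂(roundMeasure M p.H p.m) ≤ 1) (n : ℕ) :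
    Measurable (fun ω : RunNoise S A p.H p.m =>
      ∏ j ∈ Finset.range n, F (run M p tie ω j) (ω.2 j)) ∧
    ∫⁻ ω, ∏ j ∈ Finset.range n, F (run M p tie ω j) (ω.2 j) ∂(runMeasure M ν p.H p.m) ≤ 1 := by
  let κ := roundMeasure M p.H p.m
  let G : (S → A) × (Fin n → RoundNoise S A p.H p.m) → ENNReal := fun q =>
    ∏ h : Fin n, F (chain (loopStep M p tie) (State.init p.Rmax q.1) q.2 h.castSucc) (q.2 h)
  have hinit : Measurable fun π : S → A => State.init (S := S) (A := A) p.Rmax π :=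
    Measurable.of_discrete
  have hG : Measurable G := by
    refine Finset.measurable_fun_prod _ fun h _ => hF.comp (Measurable.prodMk ?_ ?_)
    · have h1 := measurable_chain (n := n)
        (measurable_loopStep (H := p.H) (m := p.m) (M := M) (p := p) (tie := tie)) h.castSucc
      have h2 := h1.comp ((hinit.comp measurable_fst).prodMk
        (measurable_snd (α := S → A) (β := Fin n → RoundNoise S A p.H p.m)))
      exact h2
    · exact (measurable_pi_apply h).comp measurable_snd
  have hmp := measurePreserving_infinitePi_fin κ n
  have hr : Measurable fun ω : RunNoise S A p.H p.m => (ω.1, fun j : Fin n => ω.2 j) :=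
    measurable_fst.prodMk (hmp.measurable.comp measurable_snd)
  have heq (ω : RunNoise S A p.H p.m) : ∏ j ∈ Finset.range n, F (run M p tie ω j) (ω.2 j)
      = G (ω.1, fun j : Fin n => ω.2 j) := by
    rw [Finset.prod_range]
    refine Finset.prod_congr rfl fun h _ => ?_
    rw [← run_eq_chain n h.castSucc]
    rfl
  simp_rw [heq]
  refine ⟨hG.comp hr, ?_⟩
  refine (lintegral_prod _ (hG.comp hr).aemeasurable).trans_le ?_
  have hin (π : S → A) : ∫⁻ ζ, G (π, fun j : Fin n => ζ j)
      ∂(Measure.infinitePi fun _ : ℕ => roundMeasure M p.H p.m) ≤ 1 := by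
    have hGπ : Measurable fun ζ => G (π, ζ) := hG.comp (measurable_const.prodMk measurable_id)
    rw [hmp.lintegral_comp hGπ]
    exact lintegral_prod_chain_le_one (n := n) κ
      (measurable_loopStep (M := M) (p := p) (tie := tie)) hF h1 (State.init p.Rmax π)
  refine (lintegral_mono hin).trans ?_
  simp

/-- Exponential Markov inequality along a run. -/
theorem runMeasure_sum_ge_le {ν : PMF (S → A)}
    {g : State S A → RoundNoise S A p.H p.m → ℝ} (hg : Measurable (Function.uncurry g))
    (h1 : ∀ σ, ∫⁻ ζ, ENNReal.ofReal (Real.exp (g σ ζ)) ∂(roundMeasure M p.H p.m) ≤ 1) (n : ℕ)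
    (x : ℝ) :
    runMeasure M ν p.H p.m
      {ω | x ≤ ∑ j ∈ Finset.range n, g (run M p tie ω j) (ω.2 j)}
        ≤ ENNReal.ofReal (Real.exp (-x)) := by
  have hF : Measurable (Function.uncurry fun σ ζ => ENNReal.ofReal (Real.exp (g σ ζ))) :=
    hg.exp.ennreal_ofReal
  obtain ⟨hm, hle⟩ := lintegral_prod_run_le_one (tie := tie) (ν := ν) hF h1 n
  have hx : ENNReal.ofReal (Real.exp x) ≠ 0 := by simp [Real.exp_pos]
  have hmk := meas_ge_le_lintegral_div (μ := runMeasure M ν p.H p.m) hm.aemeasurable hx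
    ENNReal.ofReal_ne_top
  refine (measure_mono fun ω hω => ?_).trans (hmk.trans ((ENNReal.div_le_div_right hle _).trans ?_))
  · simp only [Set.mem_ofPred_eq] at hω ⊢
    rw [← ENNReal.ofReal_prod_of_nonneg fun _ _ => (Real.exp_pos _).le, ← Real.exp_sum]
    exact ENNReal.ofReal_le_ofReal (Real.exp_le_exp.2 hω)
  · rw [one_div, ← ENNReal.ofReal_inv_of_pos (Real.exp_pos _), Real.exp_neg]

theorem lintegral_roundMeasure_fst {S A : Type*} [Fintype S] [Fintype A] [MeasurableSpace S]
    {M : MDP S A} {H m : ℕ} {f : (Fin m → EpisodeNoise S A H) → ENNReal}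
    (hf : Measurable f) :
    ∫⁻ ζ, f ζ.1 ∂(roundMeasure M H m) = ∫⁻ ξ, f ξ ∂(Measure.pi fun _ => episodeMeasure M H) :=
  measurePreserving_fst.lintegral_comp hf

/-- The deviation of the empirical frequency of `s'` among the observations from `(s, a)` has a
bounded exponential moment. -/
theorem runMeasure_deviation_ge_le {ν : PMF (S → A)} (s : S) (a : A) (s' : S) (t : ℝ) (n : ℕ)
    (x : ℝ) :
    runMeasure M ν p.H p.m
      {ω | x ≤ deviation t (M.P s a s').toReal s' ((run M p tie ω n).obs s a)}
        ≤ ENNReal.ofReal (Real.exp (-x)) := by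
  classical
  -- A stopped loop collects no observations, so its increment is zero.
  let g : State S A → RoundNoise S A p.H p.m → ℝ := fun σ ζ =>
    if M.IsEpsOptimal p.ε σ.policy then 0
    else deviation t (M.P s a s').toReal s' (nextStates σ.policy ζ.1 s a)
  have hg : Measurable (Function.uncurry g) := by
    have : DiscreteMeasurableSpace ((S → A) × (Fin p.m → EpisodeNoise S A p.H)) :=
      MeasurableSingletonClass.toDiscreteMeasurableSpace
    have h : Measurable fun q : (S → A) × (Fin p.m → EpisodeNoise S A p.H) =>
      if M.IsEpsOptimal p.ε q.1 then (0 : ℝ)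
      else deviation t (M.P s a s').toReal s' (nextStates q.1 q.2 s a) := Measurable.of_discrete
    have h' := h.comp ((measurable_policy (measurable_fst (α := State S A)
      (β := RoundNoise S A p.H p.m))).prodMk measurable_snd.fst)
    exact h'
  have h1 (σ : State S A) :
      ∫⁻ ζ, ENNReal.ofReal (Real.exp (g σ ζ)) ∂(roundMeasure M p.H p.m) ≤ 1 := by
    by_cases ho : M.IsEpsOptimal p.ε σ.policy
    · simp [g, ho]
    · simp only [g, ho, if_false]
      rw [lintegral_roundMeasure_fst (f := fun ξ => ENNReal.ofReal (Real.exp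
        (deviation t (M.P s a s').toReal s' (nextStates σ.policy ξ s a)))) Measurable.of_discrete]
      exact lintegral_exp_deviation_le_one M σ.policy s a s' t
  have hsum (ω : RunNoise S A p.H p.m) :
      deviation t (M.P s a s').toReal s' ((run M p tie ω n).obs s a)
        = ∑ j ∈ Finset.range n, g (run M p tie ω j) (ω.2 j) := by
    induction n with
    | zero => simp [run, State.init]
    | succ n ih =>
      rw [Finset.sum_range_succ, ← ih, run_succ, loopStep]
      by_cases ho : M.IsEpsOptimal p.ε (run M p tie ω n).policy
      · simp [g, ho]
      · simp [g, ho, body]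
  simp_rw [hsum]
  exact runMeasure_sum_ge_le hg h1 n x

/-- The number of visits to unknown pairs is unlikely to fall short of its conditional mean. -/
theorem runMeasure_unknownRate_ge_le {ν : PMF (S → A)} (hm : 0 < p.m) (t : ℝ) (n : ℕ) (x : ℝ) :
    runMeasure M ν p.H p.m
      {ω | (∀ i < n, ¬ M.IsEpsOptimal p.ε (run M p tie ω i).policy) ∧
        x ≤ ∑ i ∈ Finset.range n, (t * (unknownRate (run M p tie ω i).K (run M p tie ω i).policy
          (ω.2 i).1 - ∑ s, (M.μ s).toReal *
            M.expVisits (run M p tie ω i).K (run M p tie ω i).policy p.H s)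
          - t ^ 2 * (p.H : ℝ) ^ 2 / 8)}
        ≤ ENNReal.ofReal (Real.exp (-x)) := by
  classical
  -- On the event considered the loop never stops before `n`, so the zero branch is never taken and
  -- the sum of `g` is the stated one.
  let g : State S A → RoundNoise S A p.H p.m → ℝ := fun σ ζ =>
    if M.IsEpsOptimal p.ε σ.policy then 0
    else t * (unknownRate σ.K σ.policy ζ.1 - ∑ s, (M.μ s).toReal *
      M.expVisits σ.K σ.policy p.H s) - t ^ 2 * (p.H : ℝ) ^ 2 / 8
  have hg : Measurable (Function.uncurry g) := by
    have : DiscreteMeasurableSpace ((S × A → Prop) × (S → A)) :=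
      MeasurableSingletonClass.toDiscreteMeasurableSpace
    have h : Measurable fun q : ((S × A → Prop) × (S → A)) ×
        (Fin p.m → EpisodeNoise S A p.H) =>
      if M.IsEpsOptimal p.ε q.1.2 then (0 : ℝ)
      else t * (unknownRate {x | q.1.1 x} q.1.2 q.2 - ∑ s, (M.μ s).toReal *
        M.expVisits {x | q.1.1 x} q.1.2 p.H s) - t ^ 2 * (p.H : ℝ) ^ 2 / 8 :=
      measurable_of_discrete_prod _
    have h0 : Measurable fun x : State S A × RoundNoise S A p.H p.m => x.1 := measurable_fst
    have h' := h.comp (((measurable_tuple h0).fst.prodMk (measurable_policy h0)).prodMk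
      measurable_snd.fst)
    exact h'
  have h1 (σ : State S A) :
      ∫⁻ ζ, ENNReal.ofReal (Real.exp (g σ ζ)) ∂(roundMeasure M p.H p.m) ≤ 1 := by
    by_cases ho : M.IsEpsOptimal p.ε σ.policy
    · simp [g, ho]
    · simp only [g, ho, if_false]
      rw [lintegral_roundMeasure_fst (f := fun ξ => ENNReal.ofReal (Real.exp
        (t * (unknownRate σ.K σ.policy ξ - ∑ s, (M.μ s).toReal *
          M.expVisits σ.K σ.policy p.H s) - t ^ 2 * (p.H : ℝ) ^ 2 / 8))) Measurable.of_discrete]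
      exact lintegral_exp_unknownRate_le_one M hm σ.K σ.policy t
  refine (measure_mono fun ω hω => ?_).trans (runMeasure_sum_ge_le (tie := tie) hg h1 n x)
  obtain ⟨hno, hx⟩ := hω
  refine hx.trans (le_of_eq (Finset.sum_congr rfl fun i hi => ?_))
  simp [g, hno i (Finset.mem_range.1 hi)]

end Run

/-! ### Correctness of the statistical queries and of the estimated model -/

/-- By `hδ` the denominator of `α` is at least one, so every piece has length at most `2 τ`;
truncation to `[0, 1]` only shortens it. The mean and the midpoint lie in the same piece, whatever
the offset. -/
theorem rSTAT_nonneg_and_abs_sub_le {X : Type*} {τ ρ δ : ℝ} (hτ : 0 < τ) (hδ : 2 * δ ≤ ρ)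
    {sample : Multiset X} {φ : X → ℝ} (h0 : 0 ≤ (sample.map φ).sum / (sample.card : ℝ))
    (h1 : (sample.map φ).sum / (sample.card : ℝ) ≤ 1) (u : unitInterval) :
    0 ≤ rSTAT τ ρ δ sample φ u ∧
      |rSTAT τ ρ δ sample φ u - (sample.map φ).sum / (sample.card : ℝ)| ≤ τ := by
  simp only [rSTAT]
  set v := (sample.map φ).sum / (sample.card : ℝ)
  set α := 2 * τ / (ρ + 1 - 2 * δ) with hα
  have hα0 : 0 < α := div_pos (by linarith) (by linarith)
  have hα2 : α ≤ 2 * τ := div_le_self (by linarith) (by linarith)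
  set j := ⌊(v - α * u) / α⌋
  have hlo : α * u + j * α ≤ v := by
    have := Int.floor_le ((v - α * u) / α)
    rw [le_div_iff₀ hα0] at this
    linarith
  have hhi : v < α * u + (j + 1) * α := by
    have := Int.lt_floor_add_one ((v - α * u) / α)
    rw [div_lt_iff₀ hα0] at this
    linarith
  have a1 := max_le h0 hlo
  have a2 := le_min h1 hhi.le
  have a3 := le_max_left 0 (α * u + j * α)
  have a4 := le_max_right 0 (α * u + j * α)
  have a5 := min_le_right 1 (α * u + (j + 1) * α)
  refine ⟨by linarith, abs_le.2 ⟨by linarith, by linarith⟩⟩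

section Invariant

variable {S A : Type*} {H m : ℕ}

open Classical in
/-- The empirical frequency of `s'`. -/
def freq (X : Multiset S) (s' : S) : ℝ :=
  (X.map fun x => if x = s' then (1 : ℝ) else 0).sum / (X.card : ℝ)

theorem freq_mem_Icc (X : Multiset S) (s' : S) : freq X s' ∈ Set.Icc (0 : ℝ) 1 := by
  classical
  have h : 0 ≤ (X.map fun x => if x = s' then (1 : ℝ) else 0).sum ∧
      (X.map fun x => if x = s' then (1 : ℝ) else 0).sum ≤ X.card := by
    induction X using Multiset.induction with
    | empty => simp
    | cons a X ih =>
      simp only [Multiset.map_cons, Multiset.sum_cons, Multiset.card_cons]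
      push_cast
      split_ifs <;> constructor <;> linarith [ih.1, ih.2]
  -- The empty sample has frequency `0 / 0 = 0`, so it needs no exception.
  exact ⟨div_nonneg h.1 (Nat.cast_nonneg _), div_le_one_of_le₀ h.2 (Nat.cast_nonneg _)⟩

theorem card_nextStates (hm : 0 < m) (π : S → A) (ξ : Fin m → EpisodeNoise S A H) (s : S) (a : A) :
    ((nextStates π ξ s a).card : ℝ) = m * avgVisits π ξ s a := by
  have hm' : (m : ℝ) ≠ 0 := by exact_mod_cast hm.ne'
  rw [avgVisits, ← mul_assoc, mul_one_div_cancel hm', one_mul, nextStates]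
  simp only [Multiset.card_sum, apply_ite Multiset.card, Multiset.card_singleton, Multiset.card_zero]
  push_cast
  rfl

theorem avgVisits_nonneg (π : S → A) (ξ : Fin m → EpisodeNoise S A H) (s : S) (a : A) :
    0 ≤ avgVisits π ξ s a :=
  mul_nonneg (by positivity) (Finset.sum_nonneg fun j _ => Finset.sum_nonneg fun h _ => by
    split_ifs <;> simp)

theorem avgVisits_le (hm : 0 < m) (π : S → A) (ξ : Fin m → EpisodeNoise S A H) (s : S) (a : A) :
    avgVisits π ξ s a ≤ H := by
  have hm' : (0 : ℝ) < m := by exact_mod_cast hm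
  rw [avgVisits, one_div, inv_mul_le_iff₀ hm']
  refine (Finset.sum_le_card_nsmul _ _ (H : ℝ) fun j _ =>
    (Finset.sum_le_card_nsmul _ _ 1 fun h _ => by split_ifs <;> simp).trans (by simp)).trans ?_
  simp

variable [Fintype S] [Fintype A] {M : MDP S A} {p : Params}

/-- The facts about the data of the algorithm which every iteration preserves, as long as the
empirical frequencies are accurate. -/
structure Invariant (M : MDP S A) (p : Params) (m : ℕ) (e : ℝ) (σ : State S A) : Prop where
  card_obs : ∀ s a, (s, a) ∉ σ.K → ((σ.obs s a).card : ℝ) = m * σ.n s a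
  n_nonneg : ∀ s a, 0 ≤ σ.n s a
  n_le : ∀ s a, σ.n s a ≤ p.k + p.w + p.H
  n_le_of_notMem : ∀ s a, (s, a) ∉ σ.K → σ.n s a ≤ p.k + p.w
  accurate : M.IsAccurate σ.K p.Rmax e σ.model
  optimal : σ.K = ∅ ∨ σ.model.IsOptimal M.γ σ.policy

/-- On every pair with at least `m k` observations the empirical frequencies are `η`-accurate. -/
def Concentrated (M : MDP S A) (p : Params) (m : ℕ) (η : ℝ) (σ : State S A) : Prop :=
  ∀ s a s', m * p.k ≤ ((σ.obs s a).card : ℝ) →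
    |freq (σ.obs s a) s' - (M.P s a s').toReal| ≤ η

theorem invariant_init {S A : Type*} [Fintype S] {M : MDP S A} {p : Params}
    (hk : 0 ≤ p.k) (hw : 0 ≤ p.w) (e : ℝ) (π₀ : S → A) :
    Invariant M p m e (State.init p.Rmax π₀) where
  card_obs := by simp [State.init]
  n_nonneg := by simp [State.init]
  n_le := fun s a => by simp only [State.init]; positivity
  n_le_of_notMem := fun s a _ => by simp only [State.init]; positivity
  accurate := by
    refine ⟨fun s a s' => ?_, fun s a => ?_, fun s a _ s' => ?_, fun s a h => ?_⟩
    · simp only [State.init]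
      split_ifs <;> simp
    · simp [State.init, MDP.optimistic]
    · simp [State.init, MDP.optimistic]
    · simp [State.init] at h
  optimal := Or.inl rfl

/-- A pair's estimate is set once, on entering `K`. Its count has then reached `k`, hence it has at
least `m k` observations and `hc` applies; later iterations leave the estimate alone. -/
theorem invariant_body [Nonempty A] {tie : Finset (S → A) → (S → A)} {σ : State S A}
    {ζ : RoundNoise S A p.H m} {η e : ℝ}
    (h : Invariant M p m e σ) (hm : 0 < m) (hw : 0 ≤ p.w)
    (hτ : 0 < p.τSQ) (hδ : 2 * p.δSQ ≤ p.ρSQ) (hη : p.τSQ + η ≤ e) (he : 0 ≤ e)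
    (hlt : M.γ * (1 + Fintype.card S * e) < 1)
    (htie : ∀ F : Finset (S → A), F.Nonempty → tie F ∈ F)
    (hc : Concentrated M p m η (body M p tie σ ζ)) :
    Invariant M p m e (body M p tie σ ζ) := by
  classical
  have hm' : (0 : ℝ) < m := by exact_mod_cast hm
  have hobs (s : S) (a : A) (hs : (s, a) ∉ σ.K) :
      ((σ.obs s a + nextStates σ.policy ζ.1 s a).card : ℝ) = m * newCount σ ζ.1 s a := by
    rw [newCount, if_neg hs, Multiset.card_add, Nat.cast_add, h.card_obs s a hs,
      card_nextStates hm, mul_add]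
  have hacc : M.IsAccurate (σ.K ∪ newKnown p.k p.w σ ζ.1 ζ.2.1) p.Rmax e (newModel M p σ ζ) := by
    have hv (s : S) (a : A) (s' : S) :=
      rSTAT_nonneg_and_abs_sub_le hτ hδ
        (freq_mem_Icc (σ.obs s a + nextStates σ.policy ζ.1 s a) s').1
        (freq_mem_Icc (σ.obs s a + nextStates σ.policy ζ.1 s a) s').2 (ζ.2.2 s a s')
    refine ⟨fun s a s' => ?_, fun s a => ?_, fun s a hs s' => ?_, fun s a hs s' => ?_⟩
    · simp only [newModel]
      split_ifs
      · exact (hv s a s').1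
      · exact h.accurate.P_nonneg s a s'
    · by_cases hn : (s, a) ∈ newKnown p.k p.w σ ζ.1 ζ.2.1
      · simp [newModel, MDP.optimistic, hn]
      · simp [newModel, MDP.optimistic, hn, h.accurate.r_eq s a]
    · rw [Set.mem_union, not_or] at hs
      have := h.accurate.P_eq s a hs.1 s'
      simpa [newModel, MDP.optimistic, hs.1, hs.2] using this
    · by_cases hn : (s, a) ∈ newKnown p.k p.w σ ζ.1 ζ.2.1
      · simp only [newModel, if_pos hn]
        have hcard : m * p.k ≤ ((σ.obs s a + nextStates σ.policy ζ.1 s a).card : ℝ) := by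
          rw [hobs s a hn.1]
          refine mul_le_mul_of_nonneg_left ?_ hm'.le
          have := mul_nonneg hw ζ.2.1.2.1
          have := hn.2
          dsimp only at this
          linarith
        have h1 := abs_le.1 (hc s a s' hcard)
        have h2 := abs_le.1 (hv s a s').2
        simp only [body, freq] at h1
        rw [abs_le]
        constructor <;> linarith [h1.1, h1.2, h2.1, h2.2]
      · simp only [newModel, if_neg hn]
        exact h.accurate.abs_sub_le s a (hs.resolve_right hn) s'
  have hopt : (newModel M p σ ζ).IsOptimal M.γ (tie ((newModel M p σ ζ).optimalPolicies M.γ)) := by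
    -- The tie-breaking rule is meaningful only on a nonempty set of optimal policies.
    obtain ⟨π, hπ⟩ := (hacc.isContracting he hlt).exists_isOptimal
    have := htie ((newModel M p σ ζ).optimalPolicies M.γ) ⟨π, by simpa [Model.optimalPolicies]⟩
    simpa [Model.optimalPolicies] using this
  refine ⟨fun s a hs => ?_, fun s a => ?_, fun s a => ?_, fun s a hs => ?_, hacc, Or.inr hopt⟩
  · exact hobs s a fun h' => hs (Or.inl h')
  · simp only [body, newCount]
    split_ifs
    · exact h.n_nonneg s a
    · exact add_nonneg (h.n_nonneg s a) (avgVisits_nonneg _ _ _ _)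
  · simp only [body, newCount]
    split_ifs with hs
    · exact h.n_le s a
    · exact add_le_add (h.n_le_of_notMem s a hs) (avgVisits_le hm _ _ _ _)
  · simp only [body, Set.mem_union, not_or] at hs ⊢
    have hn := hs.2
    simp only [newKnown, Set.mem_ofPred_eq, not_and, not_le] at hn
    have := hn hs.1
    nlinarith [ζ.2.1.2.2]

theorem sum_n_body {tie : Finset (S → A) → (S → A)} {σ : State S A} {ζ : RoundNoise S A H m} :
    ∑ q : S × A, (body M p tie σ ζ).n q.1 q.2
      = ∑ q : S × A, σ.n q.1 q.2 + unknownRate σ.K σ.policy ζ.1 := by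
  classical
  rw [unknownRate, ← Finset.sum_add_distrib]
  refine Finset.sum_congr rfl fun q _ => ?_
  simp only [body, newCount]
  split_ifs <;> simp

/-- While the policy is not `ε`-optimal, it is expected to visit unknown pairs. -/
theorem Invariant.le_expVisits {S A : Type*} [Fintype S] {M : MDP S A} {p : Params}
    {σ : State S A} {e ε : ℝ} (h : Invariant M p m e σ)
    (hε : 0 < ε) (hε1 : ε < 1) (he : 0 ≤ e)
    (hSe : Fintype.card S * e ≤ 5 / 8 * (ε * (1 - M.γ) ^ 2))
    (hr : ∀ s a, 0 ≤ M.r s a ∧ M.r s a ≤ p.Rmax) (hR : p.Rmax ≤ 1 - M.γ) (hH0 : 0 < H)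
    (hH : M.γ ^ H ≤ ε / 2) (hopt : ¬ M.IsEpsOptimal ε σ.policy) :
    ε / 8 ≤ ∑ s, (M.μ s).toReal * M.expVisits σ.K σ.policy H s := by
  -- Before any pair is known the policy may be arbitrary, but then already the first step visits an
  -- unknown pair.
  rcases h.optimal with hK | hopt'
  · have : ∑ s, (M.μ s).toReal * 1 ≤ ∑ s, (M.μ s).toReal * M.expVisits σ.K σ.policy H s :=
      Finset.sum_le_sum fun s _ => mul_le_mul_of_nonneg_left
        (MDP.one_le_expVisits hH0 (by simp [hK])) ENNReal.toReal_nonneg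
    simp only [mul_one, MDP.sum_toReal] at this
    linarith
  · by_contra! hlt
    exact hopt (h.accurate.isEpsOptimal hε hε1 he hSe hr hR hH hopt' hlt.le)

end Invariant

/-! ### Convergence -/

section Convergence

variable {S A : Type*} [Fintype S] [Fintype A] {M : MDP S A} {p : Params}
  {tie : Finset (S → A) → (S → A)} {ω : RunNoise S A p.H p.m}

theorem sum_n_run {T : ℕ} (hT : ∀ i < T, ¬ M.IsEpsOptimal p.ε (run M p tie ω i).policy) :
    ∑ q : S × A, (run M p tie ω T).n q.1 q.2 = ∑ i ∈ Finset.range T,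
      unknownRate (run M p tie ω i).K (run M p tie ω i).policy (ω.2 i).1 := by
  induction T with
  | zero => simp [run, State.init]
  | succ T ih =>
    rw [Finset.sum_range_succ, ← ih fun i hi => hT i (hi.trans (Nat.lt_succ_self T)), run_succ,
      loopStep, if_neg (hT T (Nat.lt_succ_self T)), sum_n_body]

theorem invariant_run [Nonempty A] {η e : ℝ} (hm : 0 < p.m) (hk : 0 ≤ p.k) (hw : 0 ≤ p.w)
    (hτ : 0 < p.τSQ) (hδ : 2 * p.δSQ ≤ p.ρSQ) (hη : p.τSQ + η ≤ e) (he : 0 ≤ e)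
    (hlt : M.γ * (1 + Fintype.card S * e) < 1)
    (htie : ∀ F : Finset (S → A), F.Nonempty → tie F ∈ F) {T : ℕ}
    (hc : ∀ i ≤ T, Concentrated M p p.m η (run M p tie ω i)) {i : ℕ} (hi : i ≤ T) :
    Invariant M p p.m e (run M p tie ω i) := by
  induction i with
  | zero => exact invariant_init hk hw e ω.1
  | succ i ih =>
    have hci := hc (i + 1) hi
    rw [run_succ, loopStep] at hci ⊢
    split_ifs at hci ⊢ with ho
    · exact ih (Nat.le_of_succ_le hi)
    · exact invariant_body (ih (Nat.le_of_succ_le hi)) hm hw hτ hδ hη he hlt htie hci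

/-- An inaccurate empirical frequency makes a compensated deviation large. -/
theorem le_deviation_of_lt_abs {S : Type*} {X : Multiset S} {s' : S} {q η N : ℝ} (hη : 0 < η)
    (hN : 0 < N) (hX : N ≤ X.card) (h : η < |freq X s' - q|) :
    ∃ b : Bool, 2 * η ^ 2 * N ≤ deviation (if b then 4 * η else -(4 * η)) q s' X := by
  classical
  have hc : (0 : ℝ) < X.card := hN.trans_le hX
  have hf : (X.map fun x => if x = s' then (1 : ℝ) else 0).sum = freq X s' * X.card := by
    rw [freq, div_mul_cancel₀ _ hc.ne']
  have hη2 : 0 < η ^ 2 := by positivity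
  -- The choice `t = 4 η` maximizes `t η - t² / 8`, with maximum `2 η²`; the sign of `t` follows
  -- that of the error.
  rcases lt_abs.1 h with h | h
  · refine ⟨true, ?_⟩
    rw [deviation_apply, hf]
    simp only [if_true]
    nlinarith [mul_pos (mul_pos hη hc) (sub_pos.2 h)]
  · refine ⟨false, ?_⟩
    rw [deviation_apply, hf]
    simp only [Bool.false_eq_true, if_false]
    nlinarith [mul_pos (mul_pos hη hc) (sub_pos.2 h)]

variable [MeasurableSpace S] [DiscreteMeasurableSpace S] [MeasurableSpace A]
  [DiscreteMeasurableSpace A]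

/-- The failure probability is bounded by that of the number of visits to unknown pairs and those
of the empirical frequencies. -/
theorem runMeasure_not_isEpsOptimal_le [Nonempty S] [Nonempty A] {ν : PMF (S → A)} {η e : ℝ} {T : ℕ}
    (hr : ∀ s a, 0 ≤ M.r s a ∧ M.r s a ≤ p.Rmax) (hR : p.Rmax ≤ 1 - M.γ)
    (hε : 0 < p.ε) (hε1 : p.ε < 1) (hm : 0 < p.m) (hH0 : 0 < p.H) (hk : p.k = p.H) (hw : 0 ≤ p.w)
    (hH : M.γ ^ p.H ≤ p.ε / 2) (hτ : 0 < p.τSQ) (hδ : 2 * p.δSQ ≤ p.ρSQ) (hη0 : 0 < η)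
    (hη : p.τSQ + η ≤ e) (hSe : Fintype.card S * e ≤ 5 / 8 * (p.ε * (1 - M.γ) ^ 2))
    (htie : ∀ F : Finset (S → A), F.Nonempty → tie F ∈ F)
    (hT : Fintype.card S * Fintype.card A * (2 * p.H + p.w) ≤ T * p.ε / 16) :
    runMeasure M ν p.H p.m {ω | ¬ M.IsEpsOptimal p.ε (run M p tie ω T).policy}
      ≤ ENNReal.ofReal (Real.exp (-(T * p.ε ^ 2 / (128 * p.H ^ 2)))) +
        ENNReal.ofReal (2 * (T + 1) * Fintype.card S ^ 2 * Fintype.card A *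
          Real.exp (-(2 * η ^ 2 * (p.m * p.H)))) := by
  classical
  have he : 0 ≤ e := by linarith
  have hγ0 := M.γ_nonneg
  have hγ1 := M.γ_lt_one
  have hHr : (0 : ℝ) < p.H := by exact_mod_cast hH0
  have hmr : (0 : ℝ) < p.m := by exact_mod_cast hm
  have hlt : M.γ * (1 + Fintype.card S * e) < 1 := by
    have h1 : p.ε * (1 - M.γ) ^ 2 ≤ (1 - M.γ) ^ 2 := mul_le_of_le_one_left (sq_nonneg _) hε1.le
    have h2 : (1 - M.γ) ^ 2 ≤ 1 - M.γ := by nlinarith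
    have h3 : M.γ * (1 + Fintype.card S * e) ≤ M.γ * (1 + 5 / 8 * (1 - M.γ)) :=
      mul_le_mul_of_nonneg_left (by linarith) hγ0
    nlinarith
  -- Bad frequency events, indexed by time, pair, next state and sign of the error. Time `T` is
  -- included because the counts are bounded there.
  let E : (Fin (T + 1) × S × S × A × Bool) → Set (RunNoise S A p.H p.m) := fun x =>
    {ω | 2 * η ^ 2 * (p.m * p.H) ≤ deviation (if x.2.2.2.2 then 4 * η else -(4 * η))
      (M.P x.2.1 x.2.2.2.1 x.2.2.1).toReal x.2.2.1
      ((run M p tie ω x.1).obs x.2.1 x.2.2.2.1)}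
  -- The shortfall per iteration is `d = ε/8 - ε/16 = ε/16`, and `|t| = 4 d / H²` maximizes `|t| d -
  -- t² H² / 8`, with maximum `ε² / (128 H²)`.
  set t : ℝ := -(p.ε / (4 * p.H ^ 2)) with ht
  let B : Set (RunNoise S A p.H p.m) :=
    {ω | (∀ i < T, ¬ M.IsEpsOptimal p.ε (run M p tie ω i).policy) ∧
        T * p.ε ^ 2 / (128 * p.H ^ 2) ≤ ∑ i ∈ Finset.range T, (t * (unknownRate
          (run M p tie ω i).K (run M p tie ω i).policy
          (ω.2 i).1 - ∑ s, (M.μ s).toReal *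
            M.expVisits (run M p tie ω i).K (run M p tie ω i).policy p.H s)
          - t ^ 2 * (p.H : ℝ) ^ 2 / 8)}
  have hsub : {ω | ¬ M.IsEpsOptimal p.ε (run M p tie ω T).policy} ⊆ B ∪ ⋃ x, E x := by
    intro ω hω
    by_contra hno
    rw [Set.mem_union, Set.mem_iUnion, not_or, not_exists] at hno
    obtain ⟨hB, hE⟩ := hno
    have hopt {i : ℕ} (hi : i ≤ T) := not_isEpsOptimal_of_le hω hi
    refine hB ⟨fun i hi => hopt hi.le, ?_⟩
    have hconc : ∀ i ≤ T, Concentrated M p p.m η (run M p tie ω i) := by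
      intro i hi s a s' hcard
      by_contra! hlt'
      rw [hk] at hcard
      obtain ⟨b, hb⟩ := le_deviation_of_lt_abs hη0 (mul_pos hmr hHr) hcard hlt'
      exact hE (⟨i, Nat.lt_succ_of_le hi⟩, s, s', a, b) hb
    have hinv {i : ℕ} (hi : i ≤ T) : Invariant M p p.m e (run M p tie ω i) :=
      invariant_run hm (by linarith) hw hτ hδ hη he hlt htie hconc hi
    have hX : ∑ i ∈ Finset.range T,
        unknownRate (run M p tie ω i).K (run M p tie ω i).policy (ω.2 i).1 ≤ T * p.ε / 16 := by
      rw [← sum_n_run fun i hi => hopt hi.le]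
      refine (Finset.sum_le_card_nsmul _ _ _ fun q _ => (hinv le_rfl).n_le q.1 q.2).trans
        (le_trans (le_of_eq ?_) hT)
      rw [Finset.card_univ, Fintype.card_prod, nsmul_eq_mul, hk]
      push_cast
      ring
    have hc : T * (p.ε / 8) ≤ ∑ i ∈ Finset.range T, ∑ s, (M.μ s).toReal *
        M.expVisits (run M p tie ω i).K (run M p tie ω i).policy p.H s := by
      have := Finset.card_nsmul_le_sum (Finset.range T) (fun i => ∑ s, (M.μ s).toReal *
        M.expVisits (run M p tie ω i).K (run M p tie ω i).policy p.H s) (p.ε / 8) fun i hi =>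
          (hinv (Finset.mem_range.1 hi).le).le_expVisits hε hε1 he hSe hr hR hH0 hH
            (hopt (Finset.mem_range.1 hi).le)
      simpa using this
    rw [Finset.sum_sub_distrib, ← Finset.mul_sum, Finset.sum_sub_distrib, Finset.sum_const,
      Finset.card_range, nsmul_eq_mul]
    have h4 : 0 ≤ p.ε / (4 * p.H ^ 2) := by positivity
    have h5 : p.ε / (4 * p.H ^ 2) * (T * (p.ε / 8) - T * p.ε / 16) ≤
        p.ε / (4 * p.H ^ 2) * (∑ i ∈ Finset.range T, ∑ s, (M.μ s).toReal *
          M.expVisits (run M p tie ω i).K (run M p tie ω i).policy p.H s -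
          ∑ i ∈ Finset.range T,
            unknownRate (run M p tie ω i).K (run M p tie ω i).policy (ω.2 i).1) :=
      mul_le_mul_of_nonneg_left (sub_le_sub hc hX) h4
    have h6 : T * p.ε ^ 2 / (128 * p.H ^ 2) = p.ε / (4 * p.H ^ 2) *
        (T * (p.ε / 8) - T * p.ε / 16) - T * (t ^ 2 * (p.H : ℝ) ^ 2 / 8) := by
      rw [ht]
      field_simp
      ring
    rw [h6]
    linarith
  refine (measure_mono hsub).trans ((measure_union_le _ _).trans (add_le_add ?_ ?_))
  · exact runMeasure_unknownRate_ge_le hm t T _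
  · refine (measure_iUnion_fintype_le _ _).trans ((Finset.sum_le_card_nsmul _ _ _ fun x _ =>
      runMeasure_deviation_ge_le x.2.1 x.2.2.2.1 x.2.2.1 _ x.1 _).trans (le_of_eq ?_))
    rw [Finset.card_univ, nsmul_eq_mul, ← ENNReal.ofReal_natCast,
      ← ENNReal.ofReal_mul (Nat.cast_nonneg _)]
    congr 2
    simp only [Fintype.card_prod, Fintype.card_fin, Fintype.card_bool]
    push_cast
    ring

end Convergence

/-! ### The choice of the constants -/

theorem one_le_log_one_div {δ : ℝ} (hδ : 0 < δ) (hδ4 : δ < 1 / 4) : 1 ≤ Real.log (1 / δ) := by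
  rw [Real.le_log_iff_exp_le (by positivity)]
  have h1 : Real.exp 1 < 4 := Real.exp_one_lt_d9.trans (by norm_num)
  have h2 : 4 ≤ 1 / δ := by
    rw [le_div_iff₀ hδ]
    linarith
  linarith

/-- Fourth powers clear the roots in the assumption on `x = 1 - γ`. -/
theorem pow_four_gt_of_gt_div {x ε LD LR H A : ℝ} (hε : 0 < ε) (hLD : 0 < LD) (hLR : 0 < LR)
    (hH : 0 < H) (hA : 0 < A)
    (h : x > √ε * LD ^ (1 / 4 : ℝ) / (H * A * LR ^ (1 / 4 : ℝ))) :
    ε ^ 2 * LD ≤ x ^ 4 * (H ^ 4 * A ^ 4) * LR := by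
  have hroot {y : ℝ} (hy : 0 < y) : (y ^ (1 / 4 : ℝ)) ^ 4 = y := by
    rw [← Real.rpow_natCast, ← Real.rpow_mul hy.le]
    norm_num
  have hR := Real.rpow_pos_of_pos hLR (1 / 4)
  rw [gt_iff_lt, div_lt_iff₀ (by positivity)] at h
  have h4 := pow_le_pow_left₀ (by positivity) h.le 4
  simp only [mul_pow, hroot hLD, hroot hLR] at h4
  have hs : √ε ^ 4 = ε ^ 2 := by
    rw [show 4 = 2 * 2 from rfl, pow_mul, Real.sq_sqrt hε.le]
  rw [hs] at h4
  linarith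

/-- The number of episodes per iteration suffices for accurate empirical frequencies. -/
theorem le_two_mul_sq_mul {ε x S A H T m ρ LD LR LG : ℝ} (hε : 0 < ε) (hS : 1 ≤ S)
    (hA : 1 ≤ A) (hH : 1 ≤ H) (hρ : 0 < ρ) (hρ1 : ρ < 1) (hLD : 0 < LD) (hLR : 0 < LR)
    (hLG : 0 < LG) (hT : H * A ≤ ε * T) (hx : ε ^ 2 * LD ≤ x ^ 4 * (H ^ 4 * A ^ 4) * LR)
    (hm : 160 * (S ^ 2 * A ^ 2 * T ^ 4 * LR / ρ ^ 2 * LG) ≤ m) :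
    5 * LD * LG ≤ 2 * (ε * x ^ 2 / (8 * S)) ^ 2 * (m * H) := by
  have hHA : 0 < H ^ 4 * A ^ 4 := by positivity
  have hT4 : H ^ 4 * A ^ 4 ≤ ε ^ 4 * T ^ 4 := by
    rw [← mul_pow, ← mul_pow]
    exact pow_le_pow_left₀ (by positivity) hT 4
  -- The bound on `m` does not mention `δ`. The lower bound on `x`, together with `T ≥ H A / ε`,
  -- lets `T ^ 4` pay for `log (1/δ)`.
  have hkey : LD ≤ ε ^ 2 * T ^ 4 * x ^ 4 * LR := by
    refine le_of_mul_le_mul_right ?_ hHA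
    calc LD * (H ^ 4 * A ^ 4) ≤ LD * (ε ^ 4 * T ^ 4) := mul_le_mul_of_nonneg_left hT4 hLD.le
      _ = ε ^ 2 * T ^ 4 * (ε ^ 2 * LD) := by ring
      _ ≤ ε ^ 2 * T ^ 4 * (x ^ 4 * (H ^ 4 * A ^ 4) * LR) :=
          mul_le_mul_of_nonneg_left hx (by positivity)
      _ = _ := by ring
  have hρ2 : 1 ≤ 1 / ρ ^ 2 := by
    rw [le_div_iff₀ (by positivity), one_mul]
    exact pow_le_one₀ hρ.le hρ1.le
  have hm0 : 0 ≤ m := le_trans (by positivity) hm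
  calc 5 * LD * LG ≤ 5 * (ε ^ 2 * T ^ 4 * x ^ 4 * LR) * LG := by gcongr
    _ ≤ 5 * (ε ^ 2 * T ^ 4 * x ^ 4 * LR) * LG * (A ^ 2 * (1 / ρ ^ 2)) :=
        le_mul_of_one_le_right (by positivity)
          (one_le_mul_of_one_le_of_one_le (one_le_pow₀ hA) hρ2)
    _ = 2 * (ε * x ^ 2 / (8 * S)) ^ 2 *
          (160 * (S ^ 2 * A ^ 2 * T ^ 4 * LR / ρ ^ 2 * LG)) := by
        field_simp
        ring
    _ ≤ 2 * (ε * x ^ 2 / (8 * S)) ^ 2 * m := mul_le_mul_of_nonneg_left hm (by positivity)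
    _ ≤ 2 * (ε * x ^ 2 / (8 * S)) ^ 2 * (m * H) :=
        mul_le_mul_of_nonneg_left (le_mul_of_one_le_right hm0 hH) (by positivity)

/-- With both logarithms at least one, `5 a b ≥ a + 4 b`. The exponential is therefore at most `δ /
y ^ 4` with `y = S A T / ρ`, and `y ^ 4` absorbs the size of the union bound. -/
theorem mul_exp_neg_le_half {δ ρ S A T Z : ℝ} (hδ : 0 < δ) (hS : 1 ≤ S) (hA : 1 ≤ A)
    (hT : 256 ≤ T) (hρ : 0 < ρ) (hρ1 : ρ < 1) (hLD : 1 ≤ Real.log (1 / δ))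
    (hLG : 1 ≤ Real.log (S * A * T / ρ))
    (hZ : 5 * Real.log (1 / δ) * Real.log (S * A * T / ρ) ≤ Z) :
    2 * (T + 1) * S ^ 2 * A * Real.exp (-Z) ≤ δ / 2 := by
  set y := S * A * T / ρ with hy
  have hy0 : 0 < y := by positivity
  have hSA : 1 ≤ S * A := one_le_mul_of_one_le_of_one_le hS hA
  have hyT : S * A * T ≤ y := by
    rw [hy, le_div_iff₀ hρ]
    exact mul_le_of_le_one_right (by positivity) hρ1.le
  have hT' : T ≤ S * A * T := le_mul_of_one_le_left (by linarith) hSA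
  have hexp : Real.exp (-Z) ≤ δ / y ^ 4 := by
    have h1 : Real.exp (-Z) ≤ Real.exp (Real.log δ - 4 * Real.log y) := by
      refine Real.exp_le_exp.2 ?_
      rw [one_div, Real.log_inv] at hZ hLD
      nlinarith
    refine h1.trans (le_of_eq ?_)
    rw [Real.exp_sub, Real.exp_log hδ, show 4 * Real.log y = Real.log (y ^ 4) by
      rw [Real.log_pow]; norm_num, Real.exp_log (by positivity)]
  have h2 : 4 * (T + 1) * S ^ 2 * A ≤ y ^ 4 := by
    have e1 : 4 * (T + 1) * S ^ 2 * A ≤ 8 * (S * A * T) ^ 2 := by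
      have a1 : T + 1 ≤ 2 * T ^ 2 := by nlinarith
      have a2 : A ≤ A ^ 2 := by nlinarith
      calc 4 * (T + 1) * S ^ 2 * A ≤ 4 * (2 * T ^ 2) * S ^ 2 * A ^ 2 := by gcongr
        _ = _ := by ring
    have e2 : (S * A * T) ^ 2 ≤ y ^ 2 := pow_le_pow_left₀ (by positivity) hyT 2
    have e3 : 8 ≤ y ^ 2 := by nlinarith
    nlinarith
  calc 2 * (T + 1) * S ^ 2 * A * Real.exp (-Z) ≤ 2 * (T + 1) * S ^ 2 * A * (δ / y ^ 4) := by gcongr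
    _ = (4 * (T + 1) * S ^ 2 * A) / y ^ 4 * (δ / 2) := by ring
    _ ≤ 1 * (δ / 2) := by
        gcongr
        exact (div_le_one (by positivity)).2 h2
    _ = δ / 2 := one_mul _

theorem exp_neg_le_half {δ Z : ℝ} (hδ : 0 < δ) (hδ4 : δ < 1 / 4)
    (hZ : 2 * Real.log (1 / δ) ≤ Z) : Real.exp (-Z) ≤ δ / 2 := by
  have h1 : Real.exp (-Z) ≤ Real.exp (Real.log δ + Real.log δ) := by
    refine Real.exp_le_exp.2 ?_
    rw [one_div, Real.log_inv] at hZ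
    linarith
  rw [Real.exp_add, Real.exp_log hδ] at h1
  nlinarith

end RepRMax

end

/-! ### Assembly of the convergence lemma -/

theorem mainTheorem3 (cτ cw : ℝ) (hcτ : 0 < cτ) (hcτ' : cτ ≤ 1 / 2) (hcw : 0 < cw) :
    ∃ CT Cm : ℝ, 0 < CT ∧ 0 < Cm ∧
      ∀ (S : Type*) (A : Type*) [Fintype S] [Fintype A]
        [MeasurableSpace S] [DiscreteMeasurableSpace S]
        [MeasurableSpace A] [DiscreteMeasurableSpace A]
        (M : RepRMax.MDP S A) (Rmax ε δ ρ w : ℝ) (H T m : ℕ)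
        (ν : PMF (S → A)) (tie : Finset (S → A) → (S → A)),
        (∀ s a, 0 ≤ M.r s a ∧ M.r s a ≤ Rmax) →
        Rmax ≤ 1 - M.γ →
        0 < ε → ε < 1 → 0 < ρ → ρ < 1 → 0 < δ → δ < 1 →
        δ < ρ / 4 →
        1 - M.γ > √ε * Real.log (1 / δ) ^ (1 / 4 : ℝ) /
          (H * Fintype.card A * Real.log (1 / ρ) ^ (1 / 4 : ℝ)) →
        M.γ ^ H ≤ ε / 2 →
        CT * ((H * Fintype.card S * Fintype.card A : ℝ) / ε +
          (H : ℝ) ^ 2 * Real.log (1 / δ) / ε ^ 2) ≤ T →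
        Cm * ((Fintype.card S : ℝ) ^ 2 * (Fintype.card A : ℝ) ^ 2 * (T : ℝ) ^ 4 *
          Real.log (1 / ρ) / ρ ^ 2 *
          Real.log ((Fintype.card S : ℝ) * Fintype.card A * T / ρ)) ≤ m →
        0 ≤ w → w ≤ cw * H →
        (∀ F : Finset (S → A), F.Nonempty → tie F ∈ F) →
        RepRMax.runMeasure M ν H m
          {ω | ¬ M.IsEpsOptimal ε (RepRMax.run M
            { ε := ε
              H := H
              m := m
              k := H
              w := w
              Rmax := Rmax
              τSQ := cτ * ε * (1 - M.γ) ^ 2 / Fintype.card S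
              ρSQ := ρ / ((Fintype.card S : ℝ) ^ 2 * Fintype.card A)
              δSQ := δ / ((Fintype.card S : ℝ) ^ 2 * Fintype.card A) }
            tie ω T).policy}
          ≤ ENNReal.ofReal δ := by
  -- `16 (2 + cw)` bounds the counts by `Tε/16`; `256 = 2 * 128` makes the visit tail at most `δ²`;
  -- `160 = 5 * 64 / 2` yields the exponent `5 log(1/δ) log(SAT/ρ)` when `η = ε (1 - γ)² / (8 |S|)`.
  refine ⟨256 + 16 * (2 + cw), 160, by positivity, by norm_num, ?_⟩
  intro S A _ _ _ _ _ _ M Rmax ε δ ρ w H T m ν tie hr hR hε hε1 hρ hρ1 hδ hδ1 hδρ hγ hH hT hm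
    hw hwc htie
  have : Nonempty S := M.μ.support_nonempty.to_type
  have : Nonempty A := by
    obtain ⟨π, -⟩ := ν.support_nonempty
    exact ⟨π (Classical.arbitrary S)⟩
  have hγ1 := M.γ_lt_one
  have hx : 0 < 1 - M.γ := by linarith
  have hH0 : 0 < H := by
    rcases Nat.eq_zero_or_pos H with rfl | h
    · rw [pow_zero] at hH
      linarith
    · exact h
  have hS1 : (1 : ℝ) ≤ Fintype.card S := by exact_mod_cast Fintype.card_pos
  have hA1 : (1 : ℝ) ≤ Fintype.card A := by exact_mod_cast Fintype.card_pos
  have hH1 : (1 : ℝ) ≤ H := by exact_mod_cast hH0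
  have hδ4 : δ < 1 / 4 := by linarith
  have hLD := RepRMax.one_le_log_one_div hδ hδ4
  have hLR : 0 < Real.log (1 / ρ) := Real.log_pos (by rw [lt_div_iff₀ hρ]; linarith)
  have hfirst : (256 + 16 * (2 + cw)) * ((H * Fintype.card S * Fintype.card A : ℝ) / ε) ≤ T := by
    refine le_trans (mul_le_mul_of_nonneg_left ?_ (by positivity)) hT
    have : 0 ≤ (H : ℝ) ^ 2 * Real.log (1 / δ) / ε ^ 2 := by positivity
    linarith
  have hsecond : 256 * ((H : ℝ) ^ 2 * Real.log (1 / δ) / ε ^ 2) ≤ T := by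
    refine le_trans (mul_le_mul ?_ ?_ (by positivity) (by positivity)) hT
    · linarith
    · have : 0 ≤ (H * Fintype.card S * Fintype.card A : ℝ) / ε := by positivity
      linarith
  have hHSA : (H : ℝ) * Fintype.card A ≤ H * Fintype.card S * Fintype.card A := by
    rw [mul_right_comm]
    exact le_mul_of_one_le_right (by positivity) hS1
  have hHSA1 : 1 ≤ (H : ℝ) * Fintype.card A := one_le_mul_of_one_le_of_one_le hH1 hA1
  rw [mul_div_assoc', div_le_iff₀ hε] at hfirst
  have hεT : 256 * (H * Fintype.card S * Fintype.card A : ℝ) ≤ ε * T := by nlinarith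
  have hT256 : (256 : ℝ) ≤ T := by nlinarith
  have hLG : 1 ≤ Real.log ((Fintype.card S : ℝ) * Fintype.card A * T / ρ) := by
    rw [Real.le_log_iff_exp_le (by positivity)]
    have h1 : Real.exp 1 < 4 := Real.exp_one_lt_d9.trans (by norm_num)
    refine h1.le.trans ?_
    rw [le_div_iff₀ hρ]
    have : (T : ℝ) ≤ Fintype.card S * Fintype.card A * T :=
      le_mul_of_one_le_left (by positivity) (one_le_mul_of_one_le_of_one_le hS1 hA1)
    linarith
  have hm0 : 0 < m := by
    have : (0 : ℝ) < m := lt_of_lt_of_le (by positivity) hm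
    exact_mod_cast this
  have hx4 := RepRMax.pow_four_gt_of_gt_div hε (by linarith) hLR (by linarith) (by linarith) hγ
  have hZ := RepRMax.le_two_mul_sq_mul hε hS1 hA1 hH1 hρ hρ1 (by linarith) hLR (by linarith)
    (by linarith) hx4 hm
  -- In units of `ε (1 - γ)² / |S|` the accuracy `5/8` splits into at most `1/2` for the query (`cτ
  -- ≤ 1/2`) and `1/8` for the sampling error. The two failure probabilities receive `δ / 2` each.
  refine (RepRMax.runMeasure_not_isEpsOptimal_le (M := M) (tie := tie) (ν := ν) (T := T)
    (p := { ε := ε, H := H, m := m, k := H, w := w, Rmax := Rmax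
            τSQ := cτ * ε * (1 - M.γ) ^ 2 / Fintype.card S
            ρSQ := ρ / ((Fintype.card S : ℝ) ^ 2 * Fintype.card A)
            δSQ := δ / ((Fintype.card S : ℝ) ^ 2 * Fintype.card A) })
    (η := ε * (1 - M.γ) ^ 2 / (8 * Fintype.card S))
    (e := 5 / 8 * (ε * (1 - M.γ) ^ 2) / Fintype.card S)
    hr hR hε hε1 hm0 hH0 rfl hw hH ?_ ?_ ?_ ?_ ?_ htie ?_).trans ?_
  · dsimp only
    positivity
  · dsimp only
    rw [mul_div_assoc']
    gcongr
    linarith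
  · positivity
  · dsimp only
    have h1 : cτ * (ε * (1 - M.γ) ^ 2) ≤ 1 / 2 * (ε * (1 - M.γ) ^ 2) :=
      mul_le_mul_of_nonneg_right hcτ' (by positivity)
    calc cτ * ε * (1 - M.γ) ^ 2 / Fintype.card S + ε * (1 - M.γ) ^ 2 / (8 * Fintype.card S)
        = (cτ * (ε * (1 - M.γ) ^ 2) + 1 / 8 * (ε * (1 - M.γ) ^ 2)) / Fintype.card S := by
          field_simp
      _ ≤ 5 / 8 * (ε * (1 - M.γ) ^ 2) / Fintype.card S :=
          div_le_div_of_nonneg_right (by linarith) (by positivity)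
  · exact (mul_div_cancel₀ _ (by positivity)).le
  · dsimp only
    have h1 : (Fintype.card S : ℝ) * Fintype.card A * (2 * H + w)
        ≤ Fintype.card S * Fintype.card A * (2 * H + cw * H) := by gcongr
    have h2 : 0 ≤ (H : ℝ) * Fintype.card S * Fintype.card A := by positivity
    linarith
  · dsimp only
    rw [← ENNReal.ofReal_add (by positivity) (by positivity)]
    refine ENNReal.ofReal_le_ofReal ?_
    have h1 := RepRMax.mul_exp_neg_le_half hδ hS1 hA1 hT256 hρ hρ1 hLD hLG hZ
    have h2 : Real.exp (-(T * ε ^ 2 / (128 * (H : ℝ) ^ 2))) ≤ δ / 2 := by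
      refine RepRMax.exp_neg_le_half hδ hδ4 ?_
      rw [mul_div_assoc', div_le_iff₀ (by positivity)] at hsecond
      rw [le_div_iff₀ (by positivity)]
      linarith
    linarith
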